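/- Let $\Phi$ be an irreducible reduced (crystallographic) root system in a Euclidean space $E$ of dimension $\ell$, with Weyl group $W$, and let $Z=\{x\in E : (\alpha,x)\in\mathbb Z \text{ for all } \alpha\in\Phi\}$ be its coweight lattice. Let $h=1+n_1+\cdots+n_\ell$ be the Coxeter number of $\Phi$, where $\tilde\alpha=n_1\alpha_1+\cdots+n_\ell\alpha_\ell$ is the highest root with respect to a base $\{\alpha_1,\dots,\alpha_\ell\}$. For a positive integer $q$, let $$M(\Phi;q)=\{x+qZ\in Z/qZ : (\beta,x)\not\equiv 0 \pmod q \text{ for all } \beta\in\Phi\},$$ on which $W$ acts by $w(x+qZ)=w(x)+qZ$, and let $\chi_{\Phi,q}:W\to\mathbb C$ be the permutation character of this action, so that $\chi_{\Phi,q}(w)$ is the number of points of $M(\Phi;q)$ fixed by $w$. Then $q\mapsto\chi_{\Phi,q}$ is a quasi-polynomial: there is a unique family of functions $\chi_{\Phi,q}:W\to\mathbb C$, $q\in\mathbb Z$, that extends the above one for $q>0$ and for which there exist an integer $n\ge1$ and polynomials $f^{(r)}_w\in\mathbb Q[t]$ ($r\in\mathbb Z/n\mathbb Z$, $w\in W$)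 such that $\chi_{\Phi,q}(w)=f^{(q\bmod n)}_w(q)$ for all $q\in\mathbb Z$ and $w\in W$. It satisfies $$\chi_{\Phi,q}(w) = (-1)^\ell\,\delta(w)\,\chi_{\Phi,h-q}(w)\qquad\text{for all } q\in\mathbb Z \text{ and } w\in W,$$ where $\delta(w)=(-1)^{\ell-r(w)}$ and $r(w)$ is the dimension of the subspace of $E$ fixed by $w$. -/

import Mathlib

noncomputable section

/-- A family `X q : A → ℂ` of functions, indexed by `q : ℤ`, is a quasi-polynomial in `q`: for some
period `n ≥ 1`, the restriction of `q ↦ X q a` to each residue class modulo `n` is a polynomial in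
`q` with rational coefficients (the constituents). -/
def IsQuasiPolynomial {A : Type*} (X : ℤ → A → ℂ) : Prop :=
  ∃ n : ℕ, 0 < n ∧ ∃ f : ZMod n → A → Polynomial ℚ,
    ∀ (q : ℤ) (a : A), X q a = Polynomial.aeval (q : ℂ) (f (q : ZMod n) a)

namespace RootPairing

variable {ι M N : Type*} [AddCommGroup M] [Module ℝ M] [AddCommGroup N] [Module ℝ N]
variable (P : RootPairing ι ℝ M N)

/-- The linear action of the Weyl group on the space `N`, on which the roots are linear functionals.
(For a root system in a Euclidean space, `N` is identified with `M` through the inner product.)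
Mathlib's `coweightEquiv` is contravariant, hence the inverse. -/
def weylAct : P.weylGroup →* (N ≃ₗ[ℝ] N) where
  toFun w := (Equiv.coweightEquiv P P (w : P.Aut)).symm
  map_one' := by
    ext x
    rw [LinearEquiv.symm_apply_eq]
    rfl
  map_mul' v w := by
    ext x
    rw [LinearEquiv.symm_apply_eq, LinearEquiv.mul_apply]
    change x = (w : P.Aut).toHom.coweightMap ((v : P.Aut).toHom.coweightMap _)
    simp

/-- A reflection in the Weyl group acts on `N` as the usual reflection `x ↦ x - α(x) α^∨`. -/
lemma weylAct_ofIdx (i : ι) (x : N) :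
    P.weylAct (weylGroup.ofIdx P i) x = x - P.toLinearMap (P.root i) x • P.coroot i := by
  have h : P.coreflection i (P.weylAct (weylGroup.ofIdx P i) x) = x :=
    LinearEquiv.apply_symm_apply (Equiv.coweightEquiv P P (Equiv.reflection P i)) x
  rw [← P.coreflection_apply, ← h, P.coreflection_same, h]

/-- The pairing of weights with `N` is invariant under the Weyl group. -/
lemma toLinearMap_weylAct (w : P.weylGroup) (m : M) (x : N) :
    P.toLinearMap ((w : P.Aut) • m) (P.weylAct w x) = P.toLinearMap m x := by
  have h := LinearMap.congr_fun (Hom.weight_coweight_transpose_apply P P (P.weylAct w x)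
    (w : P.Aut).toHom) m
  have h2 : (w : P.Aut).toHom.coweightMap (P.weylAct w x) = x :=
    Equiv.coweightMap_coweightEquiv_symm P P (w : P.Aut) x
  rw [h2] at h
  exact h

/-- The coweight lattice `Z`: the points of `N` at which all roots take integer values. -/
def coweightLattice : AddSubgroup N where
  carrier := {x | ∀ i, ∃ k : ℤ, P.toLinearMap (P.root i) x = k}
  zero_mem' i := ⟨0, by simp⟩
  add_mem' {x y} hx hy i := by
    obtain ⟨k, hk⟩ := hx i
    obtain ⟨l, hl⟩ := hy i
    exact ⟨k + l, by simp [hk, hl]⟩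
  neg_mem' {x} hx i := by
    obtain ⟨k, hk⟩ := hx i
    exact ⟨-k, by simp [hk]⟩

lemma weylAct_mem_coweightLattice (w : P.weylGroup) {x : N} (hx : x ∈ P.coweightLattice) :
    P.weylAct w x ∈ P.coweightLattice := by
  intro i
  obtain ⟨k, hk⟩ := hx ((w : P.Aut).indexEquiv.symm i)
  refine ⟨k, ?_⟩
  rw [← hk, ← P.toLinearMap_weylAct w (P.root ((w : P.Aut).indexEquiv.symm i)) x,
    ← Equiv.root_indexEquiv_eq_smul, Equiv.apply_symm_apply]

/-- The action of the Weyl group on the coweight lattice. -/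
instance : DistribMulAction P.weylGroup P.coweightLattice where
  smul w x := ⟨P.weylAct w x, P.weylAct_mem_coweightLattice w x.2⟩
  one_smul x := Subtype.ext (by change P.weylAct 1 (x : N) = x; simp)
  mul_smul v w x := Subtype.ext (by
    change P.weylAct (v * w) (x : N) = P.weylAct v (P.weylAct w x); simp)
  smul_zero w := Subtype.ext (by change P.weylAct w 0 = 0; simp)
  smul_add w x y := Subtype.ext (by
    change P.weylAct w (x + y : N) = P.weylAct w x + P.weylAct w y; simp)

/-- The sublattice `q Z` of the coweight lattice `Z`. -/
def coweightMul (q : ℕ) : AddSubgroup P.coweightLattice :=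
  (nsmulAddMonoidHom q : P.coweightLattice →+ P.coweightLattice).range

/-- The group `Z / q Z`. -/
abbrev CoweightMod (q : ℕ) : Type _ := P.coweightLattice ⧸ P.coweightMul q

/-- The action `w (π_q x) = π_q (w x)` of the Weyl group on `Z / q Z`. -/
instance (q : ℕ) : MulAction P.weylGroup (P.CoweightMod q) where
  smul w := QuotientAddGroup.map (P.coweightMul q) (P.coweightMul q)
    (DistribSMul.toAddMonoidHom P.coweightLattice w) (by
      rintro _ ⟨x, rfl⟩
      exact ⟨w • x, (map_nsmul (DistribSMul.toAddMonoidHom P.coweightLattice w) q x).symm⟩)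
  one_smul y := by
    induction y using QuotientAddGroup.induction_on with
    | H x => exact congrArg QuotientAddGroup.mk (one_smul P.weylGroup x)
  mul_smul v w y := by
    induction y using QuotientAddGroup.induction_on with
    | H x => exact congrArg QuotientAddGroup.mk (mul_smul v w x)

/-- The complement `M(Φ; q)` of the Coxeter arrangement in `Z / q Z`: the classes `π_q(x)` with
`β(x) ≢ 0 (mod q)` for all roots `β`. -/
def complement (q : ℕ) : Set (P.CoweightMod q) :=
  {y | ∃ x : P.coweightLattice, QuotientAddGroup.mk x = y ∧
    ∀ i, ¬ ∃ k : ℤ, P.toLinearMap (P.root i) (x : N) = q * k}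

/-- The complement is invariant under the Weyl group. -/
def complementSubMulAction (q : ℕ) : SubMulAction P.weylGroup (P.CoweightMod q) where
  carrier := P.complement q
  smul_mem' w y := by
    rintro ⟨x, rfl, hx⟩
    refine ⟨w • x, rfl, fun i ⟨k, hk⟩ ↦ hx ((w : P.Aut).indexEquiv.symm i) ⟨k, ?_⟩⟩
    rw [← hk, ← P.toLinearMap_weylAct w (P.root ((w : P.Aut).indexEquiv.symm i)) x,
      ← Equiv.root_indexEquiv_eq_smul, Equiv.apply_symm_apply]
    rfl

/-- The permutation character `χ_{Φ,q}` of the Weyl group on `M(Φ; q)`, for `q ≥ 1`: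
its value at `w` is the number of points of `M(Φ; q)` fixed by `w`. -/
def permChar (q : ℕ) (w : P.weylGroup) : ℂ :=
  Nat.card (MulAction.fixedBy (P.complementSubMulAction q) w)

/-- `X` is the equivariant characteristic quasi-polynomial of the root system: it is a
quasi-polynomial in `q : ℤ`, and it agrees with the permutation character on `M(Φ; q)` for every
positive integer `q`. -/
def IsEquivariantCharQuasiPoly (X : ℤ → P.weylGroup → ℂ) : Prop :=
  IsQuasiPolynomial X ∧ ∀ q : ℕ, 0 < q → ∀ w, X q w = P.permChar q w

/-- `r(w)`: the dimension of the subspace of points fixed by `w`. -/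
def fixedDim (w : P.weylGroup) : ℕ :=
  Module.finrank ℝ (LinearMap.eqLocus (P.weylAct w : N →ₗ[ℝ] N) LinearMap.id)

/-- `δ(w) = (-1)^(ℓ - r(w))`. -/
def delta (w : P.weylGroup) : ℂ :=
  (-1) ^ (Module.finrank ℝ N - P.fixedDim w)

variable {P}

/-- The Coxeter number `h = 1 + n₁ + ⋯ + n_ℓ`, where the highest root is `∑ nᵢ αᵢ`. The highest
root is the root of maximal height with respect to the base, and its height is `n₁ + ⋯ + n_ℓ`. -/
def Base.coxeterNumber (b : P.Base) : ℤ :=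
  1 + ⨆ i, b.height i

/-- If `θ = ∑ nⱼ αⱼ` is the highest root, i.e. `θ - β` is a non-negative integer combination of
simple roots for every root `β`, then the Coxeter number is `1 + ∑ nⱼ`. -/
lemma Base.coxeterNumber_eq (b : P.Base) (θ : ι) (n : ι → ℤ)
    (hn : P.root θ = ∑ j ∈ b.support, n j • P.root j)
    (hθ : ∀ i, ∃ c : ι → ℕ, P.root θ - P.root i = ∑ j ∈ b.support, c j • P.root j) :
    b.coxeterNumber = 1 + ∑ j ∈ b.support, n j := by
  have hle (i : ι) : b.height i ≤ ∑ j ∈ b.support, n j := by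
    obtain ⟨c, hc⟩ := hθ i
    have h1 : P.root i = ∑ j ∈ b.support, (n j - (c j : ℤ)) • P.root j := by
      simp only [sub_smul, Finset.sum_sub_distrib, natCast_zsmul, ← hn, ← hc]
      abel
    rw [Base.height_eq_sum h1]
    exact Finset.sum_le_sum fun j _ ↦ by omega
  have hmax : b.height θ = ∑ j ∈ b.support, n j := Base.height_eq_sum hn
  have : Nonempty ι := ⟨θ⟩
  unfold Base.coxeterNumber
  congr 1
  refine le_antisymm (ciSup_le hle) ?_
  rw [← hmax]
  exact le_ciSup (f := b.height) ⟨_, by rintro _ ⟨i, rfl⟩; exact hle i⟩ θ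

end RootPairing

end

/-!
Inclusion–exclusion over sets `S` of roots writes the number of points of `M(Φ; q)` fixed by `w` as
`∑ (-1)^|S| a_S(q)`, where `a_S(q)` counts the points of `Z/qZ` that are fixed by `w` and on which
all roots in `S` vanish mod `q`. The `w`-fixed points killed by `S` form the annihilator mod `q` of
a lattice; by the Smith normal form, `a_S` is a quasi-polynomial, and `a_S(-q) = (-1)^d a_S(q)`
with `d` the dimension of the real subspace cut out by the same equations.

At `-q` the signed sum therefore has the extra signs `(-1)^d`, and Zaslavsky's theorem turns it
into `(-1)^r(w)` times a sum of numbers of regions: for each `w`-fixed `y ∈ Z/qZ`, the regions that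
the roots vanishing at `y` cut out on the fixed space of `w`. Such a pair is a corner of an alcove
of the arrangement of the hyperplanes `(α, x) ∈ qℤ`, fixed by `w` up to translation by `qZ`. All
alcoves are congruent under the extended affine Weyl group, and the fundamental one, dilated by
`h`, contains exactly one interior point of `Z`, namely `ρ`, the point of height one on every
simple root. Adding the corresponding point of each alcove to its corners gives a `W`-equivariant
bijection from the corners mod `q` onto the points of `M(Φ; q + h)`. Hence `χ_{-q}(w) = (-1)^r(w)
χ_{q+h}(w)`.
-/

noncomputable section

namespace EquivariantCharQuasiPoly

open Module

/-! ### Quasi-polynomials in one variable -/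

section QuasiPolynomial

open Polynomial

/-- Quasi-polynomials in one integer variable, with rational constituents. The constituents are
indexed by `ℤ` rather than `ℤ/n`, so that different periods can be compared. -/
def IsQuasiPoly (g : ℤ → ℂ) : Prop :=
  ∃ n : ℕ, 0 < n ∧ ∃ f : ℤ → ℚ[X], Function.Periodic f (n : ℤ) ∧
    ∀ q : ℤ, g q = aeval (q : ℂ) (f q)

namespace IsQuasiPoly

variable {g g' : ℤ → ℂ}

lemma zero : IsQuasiPoly 0 := ⟨1, one_pos, 0, fun _ ↦ rfl, by simp⟩

lemma add (hg : IsQuasiPoly g) (hg' : IsQuasiPoly g') : IsQuasiPoly (g + g') := by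
  obtain ⟨n, hn, f, hf, h⟩ := hg
  obtain ⟨n', hn', f', hf', h'⟩ := hg'
  refine ⟨n * n', Nat.mul_pos hn hn', f + f', ?_, by simp [h, h']⟩
  push_cast
  refine Function.Periodic.add ?_ (hf'.nat_mul n)
  rw [mul_comm]
  exact hf.nat_mul n'

lemma const_mul (hg : IsQuasiPoly g) (c : ℚ) : IsQuasiPoly (fun q ↦ (c : ℂ) * g q) := by
  obtain ⟨n, hn, f, hf, h⟩ := hg
  exact ⟨n, hn, fun q ↦ C c * f q, fun q ↦ by simp [hf q], fun q ↦ by simp [h]⟩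

lemma sum {κ : Type*} (s : Finset κ) {G : κ → ℤ → ℂ} (h : ∀ k ∈ s, IsQuasiPoly (G k)) :
    IsQuasiPoly (∑ k ∈ s, G k) :=
  Finset.sum_induction G IsQuasiPoly (fun _ _ ↦ add) zero h

lemma comp_mul_add (hg : IsQuasiPoly g) (m r : ℤ) : IsQuasiPoly (fun q ↦ g (m * q + r)) := by
  obtain ⟨n, hn, f, hf, h⟩ := hg
  refine ⟨n, hn, fun q ↦ (f (m * q + r)).comp (C (m : ℚ) * X + C (r : ℚ)), fun q ↦ ?_,
    fun q ↦ by simp [h, aeval_comp]⟩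
  have hshift : m * (q + n) + r = m * q + r + m * n := by ring
  simp only [hshift]
  exact congrArg (fun p : ℚ[X] ↦ p.comp _) (hf.int_mul m (m * q + r))

lemma of_periodic_mul_pow {c : ℤ → ℕ} {n : ℕ} (hn : 0 < n) (hc : Function.Periodic c (n : ℤ))
    (r : ℕ) : IsQuasiPoly (fun q ↦ (c q : ℂ) * (q : ℂ) ^ r) :=
  ⟨n, hn, fun q ↦ C (c q : ℚ) * X ^ r, fun q ↦ by simp [hc q], fun q ↦ by simp⟩

lemma eq_zero_of_pos (hg : IsQuasiPoly g) (h : ∀ q : ℤ, 0 < q → g q = 0) : g = 0 := by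
  obtain ⟨n, hn, f, hf, hgf⟩ := hg
  ext q₀
  have hroot (m : ℕ) (hm : q₀.natAbs < m) : (f q₀).IsRoot ((q₀ + m * n : ℤ) : ℚ) := by
    have hpos : 0 < q₀ + m * n := by
      have : (m : ℤ) ≤ m * n := le_mul_of_one_le_right (by positivity) (by exact_mod_cast hn)
      lia
    have hval := hgf (q₀ + m * n)
    rw [h _ hpos, hf.nat_mul m q₀] at hval
    have hcast := aeval_algebraMap_apply ℂ ((q₀ + m * n : ℤ) : ℚ) (f q₀)
    rw [map_intCast, ← hval] at hcast
    refine FaithfulSMul.algebraMap_injective ℚ ℂ ?_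
    simpa [coe_aeval_eq_eval] using hcast.symm
  have hinj : Function.Injective fun m : ℕ ↦ ((q₀ + m * n : ℤ) : ℚ) := fun a b hab ↦ by
    simpa [hn.ne'] using hab
  have hf₀ : f q₀ = 0 := eq_zero_of_infinite_isRoot _ <|
    ((Set.Ioi_infinite q₀.natAbs).image hinj.injOn).mono <| by
      rintro _ ⟨m, hm, rfl⟩
      exact hroot m hm
  simp [hgf, hf₀]

lemma ext_of_pos (hg : IsQuasiPoly g) (hg' : IsQuasiPoly g')
    (h : ∀ q : ℕ, 0 < q → g q = g' q) : g = g' := by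
  have hzero : g + (fun q ↦ ((-1 : ℚ) : ℂ) * g' q) = 0 :=
    (hg.add (hg'.const_mul (-1))).eq_zero_of_pos fun q hq ↦ by
      lift q to ℕ using hq.le
      simp [h q (by exact_mod_cast hq)]
  ext q
  simpa [← sub_eq_add_neg, sub_eq_zero] using congrFun hzero q

end IsQuasiPoly

lemma isQuasiPolynomial_iff_forall {A : Type*} [Finite A] {X : ℤ → A → ℂ} :
    IsQuasiPolynomial X ↔ ∀ a, IsQuasiPoly (fun q ↦ X q a) := by
  classical
  have := Fintype.ofFinite A
  refine ⟨fun ⟨n, hn, f, hf⟩ a ↦ ⟨n, hn, fun q ↦ f q a, fun q ↦ by simp, fun q ↦ hf q a⟩,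
    fun h ↦ ?_⟩
  choose n hn f hf hX using h
  refine ⟨∏ a, n a, Finset.prod_pos fun a _ ↦ hn a, fun r a ↦ f a (r.cast : ℤ), fun q a ↦ ?_⟩
  obtain ⟨m, hm⟩ : (n a : ℤ) ∣ ((q : ZMod (∏ a, n a)).cast : ℤ) - q :=
    (Int.natCast_dvd_natCast.mpr (Finset.dvd_prod_of_mem n (Finset.mem_univ a))).trans <| by
      rw [← ZMod.intCast_zmod_eq_zero_iff_dvd]
      simp
  have hcast : ((q : ZMod (∏ a, n a)).cast : ℤ) = q + m * n a := by linarith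
  simp only [hcast]
  exact (hX a q).trans (congrArg _ ((hf a).int_mul m q).symm)

end QuasiPolynomial

/-! ### Homomorphisms from a lattice to `ℤ/q` -/

section LatticeCounting

lemma card_zsmul_eq_zero_zmod (d : ℤ) (q : ℕ) [NeZero q] :
    Nat.card {x : ZMod q // d • x = 0} = Int.gcd d q := by
  have e : {x : ZMod q // d • x = 0} ≃ (nsmulAddMonoidHom d.natAbs : ZMod q →+ ZMod q).ker :=
    Equiv.subtypeEquivRight fun x ↦ by
      rw [AddMonoidHom.mem_ker, nsmulAddMonoidHom_apply, natAbs_nsmul_eq_zero]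
  rw [Nat.card_congr e, IsAddCyclic.card_nsmulAddMonoidHom_ker, Nat.card_zmod, Nat.gcd_comm]
  simp [Int.gcd]

variable {κ F : Type*} [AddCommGroup F]

lemma exists_basis_forall_mem_eq_zero_iff [Finite κ] (bF : Basis κ ℤ F) (L : Submodule ℤ F) :
    ∃ (e : Basis κ ℤ F) (d : κ → ℤ), ∀ {A : Type} [AddCommGroup A] (φ : F →ₗ[ℤ] A),
      (∀ a ∈ L, φ a = 0) ↔ ∀ k, d k • φ (e k) = 0 := by
  classical
  obtain ⟨n, snf⟩ := L.smithNormalForm bF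
  let d : κ → ℤ := fun k ↦ if h : ∃ i, snf.f i = k then snf.a h.choose else 0
  have hd (i : Fin n) : d (snf.f i) = snf.a i := by
    have h : ∃ j, snf.f j = snf.f i := ⟨i, rfl⟩
    simp only [d, dif_pos h, snf.f.injective h.choose_spec]
  refine ⟨snf.bM, d, fun φ ↦ ⟨fun h k ↦ ?_, fun h a ha ↦ ?_⟩⟩
  · by_cases hk : ∃ i, snf.f i = k
    · obtain ⟨i, rfl⟩ := hk
      rw [hd, ← map_smul, ← snf.snf]
      exact h _ (snf.bN i).2
    · simp [d, hk]
  · have hL : φ ∘ₗ L.subtype = 0 := snf.bN.ext fun i ↦ by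
      simpa [snf.snf, hd] using h (snf.f i)
    exact LinearMap.congr_fun hL ⟨a, ha⟩

lemma finrank_eq_card_of_forall_zsmul_eq_zero [Finite κ] (d : κ → ℤ) (U : Submodule ℝ (κ → ℝ))
    (hU : ∀ g, g ∈ U ↔ ∀ k, d k • g k = 0) :
    finrank ℝ U = Nat.card {k // d k = 0} := by
  classical
  have := Fintype.ofFinite κ
  let e : U ≃ₗ[ℝ] ({k // d k = 0} → ℝ) := LinearEquiv.ofBijective
    (LinearMap.funLeft ℝ ℝ Subtype.val ∘ₗ U.subtype) <| by
    refine ⟨(injective_iff_map_eq_zero _).2 fun u hu ↦ ?_, fun g ↦ ?_⟩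
    · ext k
      by_cases hk : d k = 0
      · exact congrFun hu ⟨k, hk⟩
      · exact (smul_eq_zero.mp ((hU u).1 u.2 k)).resolve_left hk
    · refine ⟨⟨fun k ↦ if h : d k = 0 then g ⟨k, h⟩ else 0, (hU _).2 fun k ↦ ?_⟩, ?_⟩
      · by_cases h : d k = 0 <;> simp [h]
      · ext k
        simp [LinearMap.funLeft, k.2]
  rw [e.finrank_eq, finrank_fintype_fun_eq_card, Nat.card_eq_fintype_card]

lemma card_linearMap_zmod_eq_prod_gcd [Fintype κ] (e : Basis κ ℤ F) (d : κ → ℤ) (q : ℕ)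
    [NeZero q] :
    Nat.card {φ : F →ₗ[ℤ] ZMod q // ∀ k, d k • φ (e k) = 0} = ∏ k, Int.gcd (d k) q := by
  have E : {φ : F →ₗ[ℤ] ZMod q // ∀ k, d k • φ (e k) = 0} ≃ (∀ k, {x : ZMod q // d k • x = 0}) :=
    ((e.constr ℤ).symm.toEquiv.subtypeEquiv fun φ ↦ by simp [Basis.constr]).trans
      (Equiv.subtypePiEquivPi (p := fun k x ↦ d k • x = 0))
  simp only [Nat.card_congr E, Nat.card_pi, card_zsmul_eq_zero_zmod]

lemma periodic_gcd {d : ℤ} {n : ℕ} (h : d ∣ n) :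
    Function.Periodic (fun q ↦ Int.gcd d q) (n : ℤ) := by
  obtain ⟨m, hm⟩ := h
  intro q
  simp [hm]

/-- In a diagonal form of `L`, a zero elementary divisor contributes the factor `q` to the count and
a nonzero one `d` contributes `gcd d q`, which is an even periodic function of `q`. -/
theorem exists_isQuasiPoly_card_annihilator [Finite κ] {V : Type*} [AddCommGroup V] [Module ℝ V]
    (bF : Basis κ ℤ F) (ε : V ≃ₗ[ℝ] (F →ₗ[ℤ] ℝ)) (L : Submodule ℤ F) (U : Submodule ℝ V)
    (hU : ∀ v, v ∈ U ↔ ∀ a ∈ L, ε v a = 0) :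
    ∃ g : ℤ → ℂ, IsQuasiPoly g ∧ (∀ q, g (-q) = (-1) ^ finrank ℝ U * g q) ∧
      ∀ q : ℕ, 0 < q → (Nat.card {φ : F →ₗ[ℤ] ZMod q // ∀ a ∈ L, φ a = 0} : ℂ) = g q := by
  classical
  have := Fintype.ofFinite κ
  obtain ⟨e, d, hd⟩ := exists_basis_forall_mem_eq_zero_iff bF L
  have hr : finrank ℝ U = Nat.card {k // d k = 0} := by
    let E : V ≃ₗ[ℝ] (κ → ℝ) := ε.trans (e.constr ℝ).symm
    rw [← LinearEquiv.finrank_map_eq E U,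
      finrank_eq_card_of_forall_zsmul_eq_zero d (U.map (E : V →ₗ[ℝ] (κ → ℝ))) fun g ↦ ?_]
    obtain ⟨v, rfl⟩ := E.surjective g
    rw [Submodule.mem_map_equiv, LinearEquiv.symm_apply_apply, hU, hd]
    simp [E, Basis.constr]
  set D : Finset κ := {k | d k ≠ 0} with hD
  let c : ℤ → ℕ := fun q ↦ ∏ k ∈ D, Int.gcd (d k) q
  have hc : Function.Periodic c ((∏ k ∈ D, (d k).natAbs : ℕ) : ℤ) := fun q ↦
    Finset.prod_congr rfl fun k hk ↦ periodic_gcd (Int.natAbs_dvd.mp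
      (Int.natCast_dvd_natCast.mpr (Finset.dvd_prod_of_mem (fun k ↦ (d k).natAbs) hk))) q
  refine ⟨fun q ↦ c q * q ^ finrank ℝ U, .of_periodic_mul_pow (Finset.prod_pos fun k hk ↦ ?_) hc _,
    fun q ↦ ?_, fun q hq ↦ ?_⟩
  · simpa [hD, Int.natAbs_pos] using hk
  · have hneg : c (-q) = c q := by simp [c]
    simp only [hneg, Int.cast_neg, neg_pow (q : ℂ)]
    ring
  · have : NeZero q := ⟨hq.ne'⟩
    have hzero : ∏ k with ¬ d k ≠ 0, Int.gcd (d k) q = q ^ finrank ℝ U := by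
      rw [Finset.prod_congr rfl (g := fun _ ↦ q) (fun k hk ↦ by simp_all), Finset.prod_const, hr,
        Nat.card_eq_fintype_card, Fintype.card_subtype]
      simp
    rw [Nat.card_congr (Equiv.subtypeEquivRight fun φ ↦ hd φ), card_linearMap_zmod_eq_prod_gcd,
      ← Finset.prod_filter_mul_prod_filter_not Finset.univ (fun k ↦ d k ≠ 0), hzero]
    simp [c, hD]

end LatticeCounting

/-! ### Regions of central arrangements -/

section Regions

variable {ι V : Type*} [AddCommGroup V] [Module ℝ V] {f : ι → Dual ℝ V} {C : Set V}
  {J s : Finset ι} {j : ι} {u v : V}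

variable (f J s u) in
/-- The point `u` lies on none of the hyperplanes `f j = 0`, `j ∈ J`, and `s` picks out the indices
`j ∈ J` of those for which it lies on the positive side. -/
def HasSigns : Prop :=
  ∀ j ∈ J, (j ∈ s → 0 < f j u) ∧ (j ∉ s → f j u < 0)

namespace HasSigns

lemma mem_iff (hu : HasSigns f J s u) (hj : j ∈ J) : j ∈ s ↔ 0 < f j u :=
  ⟨(hu j hj).1, fun h ↦ by_contra fun hs ↦ h.not_gt ((hu j hj).2 hs)⟩

lemma add (hu : HasSigns f J s u) (hv : HasSigns f J s v) : HasSigns f J s (u + v) := by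
  refine fun j hj ↦ ⟨fun hs ↦ ?_, fun hs ↦ ?_⟩
  · simpa using add_pos ((hu j hj).1 hs) ((hv j hj).1 hs)
  · simpa using add_neg ((hu j hj).2 hs) ((hv j hj).2 hs)

lemma smul (hu : HasSigns f J s u) {c : ℝ} (hc : 0 < c) : HasSigns f J s (c • u) := by
  refine fun j hj ↦ ⟨fun hs ↦ ?_, fun hs ↦ ?_⟩
  · simpa using mul_pos hc ((hu j hj).1 hs)
  · simpa using mul_neg_of_pos_of_neg hc ((hu j hj).2 hs)

lemma exists_add_smul (hu : HasSigns f J s u) (v : V) :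
    ∃ t : ℝ, 0 < t ∧ HasSigns f J s (u + t • v) := by
  have htend (j : ι) : Filter.Tendsto (fun t : ℝ ↦ f j (u + t • v)) (nhds 0) (nhds (f j u)) := by
    have hcont : Continuous fun t : ℝ ↦ f j u + t * f j v := by fun_prop
    simpa using hcont.tendsto 0
  have hsigns : ∀ᶠ t : ℝ in nhds 0, HasSigns f J s (u + t • v) := by
    refine (Filter.eventually_all_finset J).2 fun j hj ↦ ?_
    by_cases hs : j ∈ s
    · filter_upwards [(htend j).eventually_const_lt ((hu j hj).1 hs)] with t ht
      exact ⟨fun _ ↦ ht, absurd hs⟩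
    · filter_upwards [(htend j).eventually_lt_const ((hu j hj).2 hs)] with t ht
      exact ⟨fun h ↦ absurd h hs, fun _ ↦ ht⟩
  exact (((hsigns.filter_mono nhdsWithin_le_nhds).and self_mem_nhdsWithin).exists
    (f := nhdsWithin 0 (Set.Ioi 0))).imp fun t ht ↦ ht.symm

lemma insert_iff [DecidableEq ι] (hjs : j ∉ s) :
    HasSigns f (insert j J) s u ↔ f j u < 0 ∧ HasSigns f J s u := by
  simp [HasSigns, hjs]

lemma insert_insert_iff [DecidableEq ι] (hjJ : j ∉ J) :
    HasSigns f (insert j J) (insert j s) u ↔ 0 < f j u ∧ HasSigns f J s u := by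
  have hne : ∀ i ∈ J, i ≠ j := fun i hi hij ↦ hjJ (hij ▸ hi)
  rw [HasSigns, Finset.forall_mem_insert]
  refine and_congr (by simp) (forall₂_congr fun i hi ↦ ?_)
  simp [hne i hi]

end HasSigns

variable (f C J) in
/-- The regions of the arrangement of the hyperplanes `f j = 0`, `j ∈ J`, that meet `C`. A region is
encoded by the set of the indices `j ∈ J` for which it lies on the positive side. -/
def regions : Set (Finset ι) :=
  {s | s ⊆ J ∧ ∃ u ∈ C, HasSigns f J s u}

lemma finite_regions : (regions f C J).Finite :=
  J.powerset.finite_toSet.subset fun _ hs ↦ Finset.mem_coe.mpr (Finset.mem_powerset.mpr hs.1)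

lemma regions_empty (hC : C.Nonempty) : regions f C ∅ = {∅} := by
  obtain ⟨u, hu⟩ := hC
  ext s
  simp only [regions, Finset.subset_empty, Set.mem_ofPred_eq, Set.mem_singleton_iff, HasSigns]
  exact ⟨And.left, fun hs ↦ ⟨hs, u, hu, by simp⟩⟩

lemma regions_insert [DecidableEq ι] (hj : j ∉ J) :
    regions f C (insert j J) =
      regions f (C ∩ {u | f j u < 0}) J ∪ insert j '' regions f (C ∩ {u | 0 < f j u}) J := by
  ext s
  constructor
  · rintro ⟨hsJ, u, hu, hs⟩
    by_cases hjs : j ∈ s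
    · rw [← Finset.insert_erase hjs] at hs ⊢
      obtain ⟨hju, hs⟩ := (HasSigns.insert_insert_iff hj).1 hs
      exact .inr ⟨_, ⟨Finset.subset_insert_iff.1 hsJ, u, ⟨hu, hju⟩, hs⟩, rfl⟩
    · obtain ⟨hju, hs⟩ := (HasSigns.insert_iff hjs).1 hs
      exact .inl ⟨(Finset.subset_insert_iff_of_notMem hjs).1 hsJ, u, ⟨hu, hju⟩, hs⟩
  · rintro (⟨hsJ, u, ⟨hu, hju⟩, hs⟩ | ⟨s, ⟨hsJ, u, ⟨hu, hju⟩, hs⟩, rfl⟩)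
    · exact ⟨hsJ.trans (Finset.subset_insert j J), u, hu,
        (HasSigns.insert_iff fun hjs ↦ hj (hsJ hjs)).2 ⟨hju, hs⟩⟩
    · exact ⟨Finset.insert_subset_insert j hsJ, u, hu,
        (HasSigns.insert_insert_iff hj).2 ⟨hju, hs⟩⟩

lemma ncard_regions_insert [DecidableEq ι] (hj : j ∉ J) :
    (regions f C (insert j J)).ncard =
      (regions f (C ∩ {u | f j u < 0}) J).ncard + (regions f (C ∩ {u | 0 < f j u}) J).ncard := by
  have hdisj : Disjoint (regions f (C ∩ {u | f j u < 0}) J)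
      (insert j '' regions f (C ∩ {u | 0 < f j u}) J) := by
    rw [Set.disjoint_left]
    rintro _ h ⟨s, -, rfl⟩
    exact hj (h.1 (Finset.mem_insert_self j s))
  have hinj : Set.InjOn (insert j) (regions f (C ∩ {u | 0 < f j u}) J) := fun s hs s' hs' h ↦ by
    rw [← Finset.erase_insert fun h ↦ hj (hs.1 h), h, Finset.erase_insert fun h ↦ hj (hs'.1 h)]
  rw [regions_insert hj, Set.ncard_union_eq hdisj finite_regions (finite_regions.image _),
    hinj.ncard_image]

variable {U : Submodule ℝ V}

lemma regions_neg_union_regions_pos (hv : v ∈ U) (hjv : 0 < f j v) :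
    regions f (U ∩ {u | f j u < 0}) J ∪ regions f (U ∩ {u | 0 < f j u}) J = regions f U J := by
  ext s
  constructor
  · rintro (⟨hsJ, u, hu, hs⟩ | ⟨hsJ, u, hu, hs⟩) <;> exact ⟨hsJ, u, hu.1, hs⟩
  · rintro ⟨hsJ, u, hu, hs⟩
    rcases lt_trichotomy (f j u) 0 with hju | hju | hju
    · exact .inl ⟨hsJ, u, ⟨hu, hju⟩, hs⟩
    · obtain ⟨t, ht, hst⟩ := hs.exists_add_smul v
      exact .inr ⟨hsJ, _, ⟨U.add_mem hu (U.smul_mem t hv), by simp [hju, ht, hjv]⟩, hst⟩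
    · exact .inr ⟨hsJ, u, ⟨hu, hju⟩, hs⟩

lemma regions_neg_inter_regions_pos (hv : v ∈ U) (hjv : 0 < f j v) :
    regions f (U ∩ {u | f j u < 0}) J ∩ regions f (U ∩ {u | 0 < f j u}) J =
      regions f (U ⊓ LinearMap.ker (f j) : Submodule ℝ V) J := by
  ext s
  constructor
  · rintro ⟨⟨hsJ, u, ⟨hu, hju⟩, hs⟩, -, u', ⟨hu', hju'⟩, hs'⟩
    refine ⟨hsJ, f j u' • u + (-f j u) • u',
      ⟨U.add_mem (U.smul_mem _ hu) (U.smul_mem _ hu'), LinearMap.mem_ker.2 ?_⟩,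
      (hs.smul hju').add (hs'.smul (neg_pos.2 hju))⟩
    simp only [map_add, map_smul, smul_eq_mul]
    ring
  · rintro ⟨hsJ, u, ⟨hu, hju⟩, hs⟩
    rw [SetLike.mem_coe, LinearMap.mem_ker] at hju
    obtain ⟨t, ht, hst⟩ := hs.exists_add_smul v
    obtain ⟨t', ht', hst'⟩ := hs.exists_add_smul (-v)
    exact ⟨⟨hsJ, _, ⟨U.add_mem hu (U.smul_mem t' (U.neg_mem hv)), by simp [hju, ht', hjv]⟩, hst'⟩,
      hsJ, _, ⟨U.add_mem hu (U.smul_mem t hv), by simp [hju, ht, hjv]⟩, hst⟩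

/-- Deletion and restriction: the regions of the smaller arrangement that are cut in two by the new
hyperplane correspond to the regions of the arrangement induced on it. -/
lemma ncard_regions_insert_eq_add [DecidableEq ι] (hj : j ∉ J) (hv : v ∈ U) (hjv : f j v ≠ 0) :
    (regions f U (insert j J)).ncard =
      (regions f U J).ncard +
        (regions f (U ⊓ LinearMap.ker (f j) : Submodule ℝ V) J).ncard := by
  wlog hpos : 0 < f j v generalizing v
  · exact this (U.neg_mem hv) (by simpa using hjv)
      (by simpa using lt_of_le_of_ne (not_lt.1 hpos) hjv)
  rw [ncard_regions_insert hj, ← regions_neg_union_regions_pos hv hpos,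
    ← regions_neg_inter_regions_pos hv hpos,
    Set.ncard_union_add_ncard_inter _ _ finite_regions finite_regions]

lemma finrank_inf_ker_add_one [FiniteDimensional ℝ V] {φ : Dual ℝ V} (hv : v ∈ U) (hφ : φ v ≠ 0) :
    finrank ℝ (U ⊓ LinearMap.ker φ : Submodule ℝ V) + 1 = finrank ℝ U := by
  have hne : φ.domRestrict U ≠ 0 := fun h ↦ hφ (by simpa using LinearMap.congr_fun h ⟨v, hv⟩)
  have e := Submodule.comapSubtypeEquivOfLe (inf_le_left : U ⊓ LinearMap.ker φ ≤ U)
  rw [Submodule.comap_inf, Submodule.comap_subtype_self, top_inf_eq] at e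
  rw [← Module.Dual.finrank_ker_add_one_of_ne_zero hne, LinearMap.ker_domRestrict, e.finrank_eq]

/-- Zaslavsky's theorem for central arrangements. -/
theorem sum_neg_one_pow_finrank_eq_ncard_regions [FiniteDimensional ℝ V] (f : ι → Dual ℝ V)
    (J : Finset ι) (U : Submodule ℝ V) :
    ∑ S ∈ J.powerset, (-1 : ℤ) ^ S.card *
        (-1) ^ finrank ℝ (U ⊓ ⨅ j ∈ S, LinearMap.ker (f j) : Submodule ℝ V) =
      (-1) ^ finrank ℝ U * (regions f U J).ncard := by
  classical
  induction J using Finset.induction_on generalizing U with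
  | empty =>
    have hU : U ⊓ ⨅ j ∈ (∅ : Finset ι), LinearMap.ker (f j) = U := by simp
    rw [Finset.powerset_empty, Finset.sum_singleton, hU, regions_empty ⟨0, U.zero_mem⟩]
    simp
  | insert j J hj ih =>
    have hrestrict : ∀ S ∈ J.powerset, (-1 : ℤ) ^ (insert j S).card *
        (-1) ^ finrank ℝ (U ⊓ ⨅ i ∈ insert j S, LinearMap.ker (f i) : Submodule ℝ V) =
        -((-1 : ℤ) ^ S.card * (-1) ^ finrank ℝ
          ((U ⊓ LinearMap.ker (f j)) ⊓ ⨅ i ∈ S, LinearMap.ker (f i) : Submodule ℝ V)) := by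
      intro S hS
      have hjS : j ∉ S := fun h ↦ hj (Finset.mem_powerset.mp hS h)
      rw [Finset.card_insert_of_notMem hjS, Finset.iInf_insert, inf_assoc, pow_succ]
      ring
    rw [Finset.sum_powerset_insert hj, Finset.sum_congr rfl hrestrict, Finset.sum_neg_distrib, ih,
      ih]
    by_cases hU : ∀ v ∈ U, f j v = 0
    · have hker : U ⊓ LinearMap.ker (f j) = U := inf_eq_left.mpr hU
      have hempty : regions f U (insert j J) = ∅ :=
        Set.eq_empty_of_forall_notMem fun s ⟨_, u, hu, hs⟩ ↦ by
          have := hs j (Finset.mem_insert_self j J)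
          by_cases hjs : j ∈ s <;> simp_all
      rw [hker, hempty]
      simp
    · push Not at hU
      obtain ⟨v, hv, hjv⟩ := hU
      rw [ncard_regions_insert_eq_add hj hv hjv, ← finrank_inf_ker_add_one hv hjv, pow_succ]
      push_cast
      ring

end Regions

/-! ### The highest root -/

section HighestRoot

open RootPairing RootPairing.Base

variable {ι K M N : Type*} [Field K] [AddCommGroup M] [Module K M] [AddCommGroup N]
  [Module K N] {P : RootPairing ι K M N} {b : P.Base} {i j k θ θ' : ι}

variable (b) in
/-- The root order: `i ≤ j` if the difference of the roots `j` and `i` is a sum of simple roots. -/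
def RootLE (i j : ι) : Prop :=
  P.root j - P.root i ∈ AddSubmonoid.closure (P.root '' b.support)

lemma RootLE.refl (i : ι) : RootLE b i i := by
  simp [RootLE]

lemma RootLE.trans (hij : RootLE b i j) (hjk : RootLE b j k) : RootLE b i k := by
  simpa [RootLE] using add_mem hjk hij

variable [CharZero K]

lemma root_mem_closure_of_isPos [Finite ι] [P.IsCrystallographic] (h : b.IsPos i) :
    P.root i ∈ AddSubmonoid.closure (P.root '' b.support) :=
  h.induction_on_add (p := fun i ↦ P.root i ∈ AddSubmonoid.closure (P.root '' b.support))
    (fun i hi ↦ AddSubmonoid.subset_closure ⟨i, hi, rfl⟩)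
    fun _ j _ hk hi hj ↦ hk ▸ add_mem hi (AddSubmonoid.subset_closure ⟨j, hj, rfl⟩)

lemma exists_coeff_nonneg_of_isPos (h : b.IsPos i) :
    ∃ f : ι → ℤ, (∀ j, 0 ≤ f j) ∧ P.root i = ∑ j ∈ b.support, f j • P.root j := by
  obtain ⟨f, -, hf | hf, hsum⟩ := b.exists_root_eq_sum_int i
  · exact ⟨f, hf.le, hsum⟩
  · rw [isPos_iff, height_eq_sum hsum] at h
    exact absurd h (not_lt.mpr (Finset.sum_nonpos fun j _ ↦ hf.le j))

lemma pairingIn_eq_sum_support [P.IsCrystallographic] {f : ι → ℤ}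
    (h : P.root i = ∑ j ∈ b.support, f j • P.root j) (k : ι) :
    P.pairingIn ℤ i k = ∑ j ∈ b.support, f j * P.pairingIn ℤ j k := by
  apply FaithfulSMul.algebraMap_injective ℤ K
  simp_rw [algebraMap_pairingIn, map_sum, map_mul, algebraMap_pairingIn, ← root_coroot_eq_pairing,
    h, map_sum, map_zsmul, LinearMap.coe_sum, Finset.sum_apply, LinearMap.smul_apply, zsmul_eq_mul]
  rfl

variable (b) in
/-- A root of maximal height among the roots above it in the root order. Every root lies below a
maximal one, and in the irreducible case the maximal root is unique: it is the highest root. -/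
def IsMaximalRoot (θ : ι) : Prop :=
  ∀ k, RootLE b θ k → b.height k ≤ b.height θ

variable (b) in
lemma exists_isMaximalRoot_ge [Finite ι] (i : ι) : ∃ θ, IsMaximalRoot b θ ∧ RootLE b i θ := by
  obtain ⟨θ, hθ, hmax⟩ :=
    Set.exists_max_image {k | RootLE b i k} b.height (Set.toFinite _) ⟨i, .refl i⟩
  exact ⟨θ, fun k hk ↦ hmax k (hθ.trans hk), hθ⟩

namespace IsMaximalRoot

variable [Finite ι] [P.IsCrystallographic]

lemma isPos (h : IsMaximalRoot b θ) : b.IsPos θ := by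
  let := P.indexNeg
  by_contra hneg
  have hpos := (IsPos.neg_iff_not b θ).2 hneg
  have hmem := root_mem_closure_of_isPos hpos
  have hle := h (-θ) (by simpa [RootLE, sub_eq_add_neg] using add_mem hmem hmem)
  rw [isPos_iff] at hneg hpos
  lia

lemma pairingIn_nonneg (h : IsMaximalRoot b θ) (hj : j ∈ b.support) : 0 ≤ P.pairingIn ℤ θ j := by
  by_contra! hneg
  have hne : P.root θ ≠ -P.root j := by
    intro hθ
    let := P.indexNeg
    have : θ = -j := P.root.injective (by simp [hθ])
    have hpos := (isPos_iff b).1 h.isPos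
    rw [this, height_reflectionPerm_self, height_one_of_mem_support hj] at hpos
    lia
  obtain ⟨k, hk⟩ := P.root_add_root_mem_of_pairingIn_neg hneg hne
  have hle := h k (by
    rw [RootLE, hk, add_sub_cancel_left]
    exact AddSubmonoid.subset_closure ⟨j, hj, rfl⟩)
  rw [b.height_add hk, height_one_of_mem_support hj] at hle
  lia

/-- Every term of `⟨θ, αᵢ^∨⟩ = ∑ fₗ ⟨αₗ, αᵢ^∨⟩ ≥ 0` is nonpositive, hence zero. -/
lemma pairing_eq_zero_of_coeff (h : IsMaximalRoot b θ) {f : ι → ℤ} (hf : ∀ j, 0 ≤ f j)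
    (hθ : P.root θ = ∑ j ∈ b.support, f j • P.root j) (hi : i ∈ b.support) (hfi : f i = 0)
    (hk : k ∈ b.support) (hfk : 0 < f k) : P.pairing k i = 0 := by
  have hle : ∀ l ∈ b.support, f l * P.pairingIn ℤ l i ≤ 0 := by
    intro l hl
    rcases eq_or_ne l i with rfl | hli
    · simp [hfi]
    · exact mul_nonpos_of_nonneg_of_nonpos (hf l) (b.pairingIn_le_zero_of_ne hli hl hi)
  have hsum : ∑ l ∈ b.support, f l * P.pairingIn ℤ l i = 0 :=
    le_antisymm (Finset.sum_nonpos hle) (pairingIn_eq_sum_support hθ i ▸ h.pairingIn_nonneg hi)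
  have hzero := (Finset.sum_eq_zero_iff_of_nonpos hle).1 hsum k hk
  rw [← P.algebraMap_pairingIn ℤ, (mul_eq_zero.mp hzero).resolve_left hfk.ne', map_zero]

lemma span_coeff_pos_mem_invtSubmodule (h : IsMaximalRoot b θ) {f : ι → ℤ} (hf : ∀ j, 0 ≤ f j)
    (hθ : P.root θ = ∑ j ∈ b.support, f j • P.root j) (hi : i ∈ b.support) :
    Submodule.span K (P.root '' {k | k ∈ b.support ∧ 0 < f k}) ∈
      Module.End.invtSubmodule (P.reflection i) := by
  rw [Module.End.mem_invtSubmodule, Submodule.span_le]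
  rintro _ ⟨k, ⟨hk, hfk⟩, rfl⟩
  change P.reflection i (P.root k) ∈ Submodule.span _ _
  rw [P.reflection_apply_root]
  have hk_mem := Submodule.subset_span (R := K)
    (Set.mem_image_of_mem P.root (show k ∈ {k | k ∈ b.support ∧ 0 < f k} from ⟨hk, hfk⟩))
  rcases (hf i).eq_or_lt with hfi | hfi
  · rwa [h.pairing_eq_zero_of_coeff hf hθ hi hfi.symm hk hfk, zero_smul, sub_zero]
  · exact Submodule.sub_mem _ hk_mem
      (Submodule.smul_mem _ _ (Submodule.subset_span ⟨i, ⟨hi, hfi⟩, rfl⟩))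

variable [P.IsReduced] [P.IsIrreducible]

lemma coeff_pos (h : IsMaximalRoot b θ) {f : ι → ℤ} (hf : ∀ j, 0 ≤ f j)
    (hθ : P.root θ = ∑ j ∈ b.support, f j • P.root j) (hj : j ∈ b.support) : 0 < f j := by
  by_contra hfj
  set J : Set ι := {k | k ∈ b.support ∧ 0 < f k}
  have hne : Submodule.span K (P.root '' J) ≠ ⊥ := by
    intro hbot
    refine P.ne_zero θ (hθ ▸ Finset.sum_eq_zero fun i hi ↦ ?_)
    rcases (hf i).eq_or_lt with h0 | h0
    · simp [← h0]
    · have : P.root i ∈ Submodule.span K (P.root '' J) :=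
        Submodule.subset_span ⟨i, ⟨hi, h0⟩, rfl⟩
      exact absurd (by simpa [hbot] using this) (P.ne_zero i)
  have htop := IsIrreducible.eq_top_of_invtSubmodule_reflection (P := P) _
    ((b.forall_mem_support_invtSubmodule_iff _).1
      fun i hi ↦ h.span_coeff_pos_mem_invtSubmodule hf hθ hi) hne
  refine LinearIndepOn.notMem_span_of_insert (b.linearIndepOn_root.mono ?_) (fun h ↦ hfj h.2)
    (htop ▸ Submodule.mem_top : P.root j ∈ Submodule.span K (P.root '' J))
  exact Set.insert_subset hj fun i hi ↦ hi.1

lemma pairingIn_pos (h : IsMaximalRoot b θ) (h' : IsMaximalRoot b θ') :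
    0 < P.pairingIn ℤ θ' θ := by
  obtain ⟨f, hf, hf'⟩ := exists_coeff_nonneg_of_isPos h'.isPos
  have hnonneg : ∀ j ∈ b.support, 0 ≤ P.pairingIn ℤ j θ := fun j hj ↦ by
    rcases (h.pairingIn_nonneg hj).eq_or_lt with h0 | h0
    · exact (P.pairingIn_eq_zero_iff.1 h0.symm).ge
    · exact ((P.zero_lt_pairingIn_iff' ℤ).1 h0).le
  obtain ⟨i, hi, hi0⟩ := h.isPos.exists_mem_support_pos_pairingIn
  rw [pairingIn_eq_sum_support hf']
  exact Finset.sum_pos' (fun j hj ↦ mul_nonneg (hf j) (hnonneg j hj))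
    ⟨i, hi, mul_pos (h'.coeff_pos hf hf' hi) hi0⟩

lemma unique (h : IsMaximalRoot b θ) (h' : IsMaximalRoot b θ') : θ' = θ := by
  by_contra hne
  obtain ⟨k, hk⟩ := P.root_sub_root_mem_of_pairingIn_pos (h.pairingIn_pos h') hne
  let := P.indexNeg
  have hheight := b.height_sub hk
  rcases IsPos.or_neg b k with hpos | hpos <;> have hmem := root_mem_closure_of_isPos hpos
  · have hle := h θ' (by rwa [RootLE, ← hk])
    rw [isPos_iff] at hpos
    lia
  · have hneg : P.root (-k) = P.root θ - P.root θ' := by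
      rw [indexNeg_neg, root_reflectionPerm, RootPairing.reflection_apply_self, hk, neg_sub]
    have hle := h' θ (by rwa [RootLE, ← hneg])
    rw [isPos_iff, height_reflectionPerm_self] at hpos
    lia

end IsMaximalRoot

variable (b) in
theorem exists_highest_root [Finite ι] [Nonempty ι] [P.IsCrystallographic] [P.IsReduced]
    [P.IsIrreducible] : ∃ θ, ∀ i, RootLE b i θ := by
  obtain ⟨θ, hθ, -⟩ := exists_isMaximalRoot_ge b (Classical.arbitrary ι)
  refine ⟨θ, fun i ↦ ?_⟩
  obtain ⟨θ', hθ', h⟩ := exists_isMaximalRoot_ge b i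
  rwa [hθ.unique hθ'] at h

end HighestRoot

/-! ### Integer values of the roots on the coweight lattice -/

section RootValues

open RootPairing

variable {ι M N : Type*} [AddCommGroup M] [Module ℝ M] [AddCommGroup N] [Module ℝ N]

/-- The permutation of the roots given by an element of the Weyl group. -/
abbrev weylPerm {P : RootPairing ι ℝ M N} (w : P.weylGroup) : ι ≃ ι := (w : P.Aut).indexEquiv

/-- The integer value of the root `i` at a point of the coweight lattice. -/
def rootVal (P : RootPairing ι ℝ M N) (i : ι) : P.coweightLattice →+ ℤ where
  toFun x := (x.2 i).choose
  map_zero' := by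
    have h : P.root' i 0 = (((0 : P.coweightLattice).2 i).choose : ℝ) :=
      ((0 : P.coweightLattice).2 i).choose_spec
    rw [map_zero] at h
    exact_mod_cast h.symm
  map_add' x y := by
    have h : P.root' i (x + y) = (((x + y).2 i).choose : ℝ) := ((x + y).2 i).choose_spec
    rw [map_add, (x.2 i).choose_spec, (y.2 i).choose_spec] at h
    exact_mod_cast h.symm

variable {P : RootPairing ι ℝ M N}

lemma coe_rootVal (i : ι) (x : P.coweightLattice) : (rootVal P i x : ℝ) = P.root' i (x : N) :=
  ((x.2 i).choose_spec).symm

lemma rootVal_neg (i : ι) (x : P.coweightLattice) :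
    letI := P.indexNeg
    rootVal P (-i) x = -rootVal P i x := by
  let := P.indexNeg
  apply Int.cast_injective (α := ℝ)
  rw [Int.cast_neg, coe_rootVal, coe_rootVal]
  simp [root']

lemma root'_weylPerm_weylAct (w : P.weylGroup) (i : ι) (v : N) :
    P.root' (weylPerm w i) (P.weylAct w v) = P.root' i v := by
  rw [← P.toLinearMap_weylAct w (P.root i) v, ← Equiv.root_indexEquiv_eq_smul]

lemma coe_smul_coweightLattice (w : P.weylGroup) (x : P.coweightLattice) :
    ((w • x : P.coweightLattice) : N) = P.weylAct w x := rfl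

lemma rootVal_weylPerm_smul (w : P.weylGroup) (i : ι) (x : P.coweightLattice) :
    rootVal P (weylPerm w i) (w • x) = rootVal P i x := by
  apply Int.cast_injective (α := ℝ)
  rw [coe_rootVal, coe_rootVal, coe_smul_coweightLattice, root'_weylPerm_weylAct]

lemma rootVal_inv_smul (w : P.weylGroup) (i : ι) (x : P.coweightLattice) :
    rootVal P i (w⁻¹ • x) = rootVal P (weylPerm w i) x := by
  rw [← rootVal_weylPerm_smul w, smul_inv_smul]

lemma rootSpanMem_eq_sum (b : P.Base) {f : ι → ℤ} {i : ι}
    (hf : P.root i = ∑ j ∈ b.support, f j • P.root j) :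
    P.rootSpanMem ℤ i = ∑ j : b.support, f j • b.toWeightBasisInt j := by
  apply Subtype.ext
  rw [Submodule.coe_sum]
  simp only [Submodule.coe_smul, Base.coe_toWeightBasisInt_apply]
  rw [Finset.sum_coe_sort b.support fun j ↦ f j • P.root j]
  exact hf

lemma rootVal_le_of_rootLE {b : P.Base} {i j : ι} {x : P.coweightLattice}
    (hx : ∀ l ∈ b.support, 0 ≤ rootVal P l x) (h : RootLE b i j) :
    rootVal P i x ≤ rootVal P j x := by
  have hnonneg : ∀ m ∈ AddSubmonoid.closure (P.root '' b.support), 0 ≤ P.toLinearMap m (x : N) := by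
    intro m hm
    induction hm using AddSubmonoid.closure_induction with
    | mem m hm =>
      obtain ⟨l, hl, rfl⟩ := hm
      exact (Int.cast_nonneg (hx l hl)).trans_eq (coe_rootVal l x)
    | zero => simp
    | add m m' _ _ h h' => rw [map_add, LinearMap.add_apply]; positivity
  have hsub := hnonneg _ h
  rw [map_sub, LinearMap.sub_apply, sub_nonneg] at hsub
  rw [← Int.cast_le (R := ℝ), coe_rootVal, coe_rootVal]
  exact hsub

lemma rootVal_nonneg_of_isPos [Finite ι] [P.IsCrystallographic] {b : P.Base} {i : ι}
    (hi : b.IsPos i) {x : P.coweightLattice} (hx : ∀ l ∈ b.support, 0 ≤ rootVal P l x) :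
    0 ≤ rootVal P i x := by
  let := P.indexNeg
  have hmem := root_mem_closure_of_isPos hi
  have hle : RootLE b (-i) i := by simpa [RootLE] using add_mem hmem hmem
  have := rootVal_le_of_rootLE hx hle
  rw [rootVal_neg] at this
  lia

section RootSystem

variable [P.IsRootSystem]

lemma eq_of_forall_root'_eq {v v' : N} (h : ∀ i, P.root' i v = P.root' i v') : v = v' :=
  sub_eq_zero.mp <| (P.flip.eq_zero_iff_forall_coroot'_eq_zero (x := v - v')).2 fun i ↦
    (map_sub (P.root' i) v v').trans (sub_eq_zero.mpr (h i))

lemma rootVal_ext {x y : P.coweightLattice} (h : ∀ i, rootVal P i x = rootVal P i y) : x = y :=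
  Subtype.ext <| eq_of_forall_root'_eq (P := P) fun i ↦ by
    rw [← coe_rootVal, ← coe_rootVal, h]

lemma finite_weylGroup [Finite ι] : Finite P.weylGroup := by
  refine Finite.of_injective (fun w : P.weylGroup ↦ weylPerm w) fun w w' h ↦ ?_
  refine Subtype.ext (Equiv.weightHom_injective P (LinearEquiv.toLinearMap_injective ?_))
  refine LinearMap.ext_on (s := Set.range P.root) IsRootSystem.span_root_eq_top ?_
  rintro _ ⟨i, rfl⟩
  change (w : P.Aut) • P.root i = (w' : P.Aut) • P.root i
  rw [← Equiv.root_indexEquiv_eq_smul, ← Equiv.root_indexEquiv_eq_smul]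
  exact congrArg P.root (Equiv.congr_fun h i)

lemma weylAct_eq_self_iff {w : P.weylGroup} {v : N} :
    P.weylAct w v = v ↔ ∀ i, P.root' (weylPerm w i) v = P.root' i v := by
  refine ⟨fun h i ↦ ?_, fun h ↦ eq_of_forall_root'_eq (P := P) fun i ↦ ?_⟩
  · rw [← root'_weylPerm_weylAct w i v, h]
  · obtain ⟨i, rfl⟩ := (weylPerm w).surjective i
    rw [root'_weylPerm_weylAct, h]

variable (b : P.Base)

/-- A base identifies `N` with the space of real functionals on the root lattice. -/
def realEquiv : N ≃ₗ[ℝ] (P.rootSpan ℤ →ₗ[ℤ] ℝ) :=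
  (P.flip.toPerfPair.trans (b.toWeightBasis.constr ℝ).symm).trans (b.toWeightBasisInt.constr ℝ)

lemma realEquiv_apply (v : N) (a : P.rootSpan ℤ) :
    realEquiv b v a = P.toLinearMap (a : M) v := by
  let g : P.rootSpan ℤ →ₗ[ℤ] ℝ :=
    { toFun := fun a ↦ P.toLinearMap (a : M) v
      map_add' := by simp
      map_smul' := by simp }
  have h : realEquiv b v = g := b.toWeightBasisInt.ext fun j ↦ by
    simp only [realEquiv, LinearEquiv.trans_apply, Basis.constr_basis]
    change P.toLinearMap (b.toWeightBasis j) v = P.toLinearMap (b.toWeightBasisInt j : M) v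
    simp
  rw [h]
  rfl

include b in
lemma exists_rootVal_eq (ψ : P.rootSpan ℤ →ₗ[ℤ] ℤ) :
    ∃ x : P.coweightLattice, ∀ i, rootVal P i x = ψ (P.rootSpanMem ℤ i) := by
  let v : N := (realEquiv b).symm ((Int.castAddHom ℝ).toIntLinearMap ∘ₗ ψ)
  have hv (i : ι) : P.root' i v = (ψ (P.rootSpanMem ℤ i) : ℤ) :=
    (realEquiv_apply b v (P.rootSpanMem ℤ i)).symm.trans <| by
      rw [LinearEquiv.apply_symm_apply]
      rfl
  refine ⟨⟨v, fun i ↦ ⟨_, hv i⟩⟩, fun i ↦ ?_⟩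
  apply Int.cast_injective (α := ℝ)
  rw [coe_rootVal, ← hv]

lemma exists_rootVal_eq_height : ∃ ρ : P.coweightLattice, ∀ i, rootVal P i ρ = b.height i := by
  obtain ⟨ρ, hρ⟩ := exists_rootVal_eq b (b.toWeightBasisInt.constr ℤ fun _ ↦ 1)
  refine ⟨ρ, fun i ↦ ?_⟩
  obtain ⟨f, -, -, hf⟩ := b.exists_root_eq_sum_int i
  rw [hρ, rootSpanMem_eq_sum b hf, Base.height_eq_sum hf, map_sum,
    ← Finset.sum_coe_sort b.support f]
  exact Finset.sum_congr rfl fun j _ ↦ by rw [map_smul, Basis.constr_basis, smul_eq_mul, mul_one]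

end RootSystem

end RootValues

/-! ### Moving points by the affine Weyl group -/

section AffineWeyl

open RootPairing

variable {ι M N : Type*} [AddCommGroup M] [Module ℝ M] [AddCommGroup N] [Module ℝ N]
  {P : RootPairing ι ℝ M N}

variable (P) in
/-- The squared distance from `p` to `p₀` in the Weyl-invariant metric `v ↦ ∑ α(v)²`. -/
def sqDist [Fintype ι] (p p₀ : N) : ℝ :=
  ∑ j, P.root' j (p - p₀) ^ 2

/-- The permutation `sᵢ` of the roots turns the sum on the left into its negative, up to the
multiple `αᵢ(v) ∑ⱼ ⟨αⱼ, αᵢ^∨⟩²`. -/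
lemma two_mul_sum_pairing_mul_root' [Fintype ι] (i : ι) (v : N) :
    2 * ∑ j, P.pairing j i * P.root' j v = P.root' i v * ∑ j, P.pairing j i ^ 2 := by
  have hreflect : ∑ j, P.pairing j i * P.root' j v =
      ∑ j, -(P.pairing j i * (P.root' j v - P.pairing j i * P.root' i v)) := by
    rw [← Equiv.sum_comp (P.reflectionPerm i)]
    refine Finset.sum_congr rfl fun j _ ↦ ?_
    have hpair : P.pairing (P.reflectionPerm i j) i = -P.pairing j i := by
      rw [← P.pairing_reflectionPerm, P.pairing_reflectionPerm_self_right]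
    have hroot : P.root' (P.reflectionPerm i j) v =
        P.root' j v - P.pairing j i * P.root' i v := by
      simp [root', P.reflection_apply_root]
    rw [hpair, hroot, neg_mul]
  have hsplit : ∑ j, -(P.pairing j i * (P.root' j v - P.pairing j i * P.root' i v)) =
      -∑ j, P.pairing j i * P.root' j v + P.root' i v * ∑ j, P.pairing j i ^ 2 := by
    rw [Finset.mul_sum, ← Finset.sum_neg_distrib, ← Finset.sum_add_distrib]
    exact Finset.sum_congr rfl fun j _ ↦ by ring
  linarith

lemma sqDist_reflection_lt [Fintype ι] (i : ι) (m : ℝ) (p p₀ : N)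
    (hsep : (P.root' i p - m) * (P.root' i p₀ - m) < 0) :
    sqDist P (p - (P.root' i p - m) • P.coroot i) p₀ < sqDist P p p₀ := by
  set c := P.root' i p - m with hc
  have hexpand : sqDist P (p - c • P.coroot i) p₀ = sqDist P p p₀ -
      c * (2 * ∑ j, P.pairing j i * P.root' j (p - p₀)) + c ^ 2 * ∑ j, P.pairing j i ^ 2 := by
    simp only [sqDist, Finset.mul_sum]
    rw [← Finset.sum_sub_distrib, ← Finset.sum_add_distrib]
    refine Finset.sum_congr rfl fun j _ ↦ ?_
    rw [sub_right_comm, map_sub, map_smul, P.root'_coroot_eq_pairing, smul_eq_mul]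
    ring
  have hpos : 0 < ∑ j, P.pairing j i ^ 2 :=
    Finset.sum_pos' (fun j _ ↦ sq_nonneg _) ⟨i, Finset.mem_univ i, by simp⟩
  have hdiff : P.root' i (p - p₀) = c - (P.root' i p₀ - m) := by rw [map_sub, hc]; ring
  rw [hexpand, two_mul_sum_pairing_mul_root', hdiff]
  linarith [mul_neg_of_neg_of_pos hsep hpos]

variable (P) in
/-- The orbit of `p` under the extended affine Weyl group, the semidirect product of the Weyl group
and the translations from the coweight lattice. -/
def extendedAffineOrbit (p : N) : Set N :=
  {y | ∃ (w : P.weylGroup) (z : P.coweightLattice), P.weylAct w p + z = y}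

lemma self_mem_extendedAffineOrbit (p : N) : p ∈ extendedAffineOrbit P p :=
  ⟨1, 0, by simp⟩

lemma coroot_mem_coweightLattice [P.IsCrystallographic] (i : ι) :
    P.coroot i ∈ P.coweightLattice := fun j ↦
  ⟨P.pairingIn ℤ j i, by rw [P.root_coroot_eq_pairing, ← P.algebraMap_pairingIn ℤ]; rfl⟩

lemma reflection_mem_extendedAffineOrbit [P.IsCrystallographic] {p y : N}
    (hy : y ∈ extendedAffineOrbit P p) (i : ι) (m : ℤ) :
    y - (P.root' i y - m) • P.coroot i ∈ extendedAffineOrbit P p := by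
  obtain ⟨w, z, rfl⟩ := hy
  refine ⟨weylGroup.ofIdx P i * w,
    weylGroup.ofIdx P i • z + m • ⟨P.coroot i, coroot_mem_coweightLattice i⟩, ?_⟩
  rw [map_mul, LinearEquiv.mul_apply, AddSubgroup.coe_add, coe_smul_coweightLattice,
    AddSubgroup.coe_zsmul, ← add_assoc, ← map_add, P.weylAct_ofIdx, sub_smul,
    Int.cast_smul_eq_zsmul, sub_sub_eq_add_sub]
  simp only [root']
  abel

variable [P.IsRootSystem]

lemma finite_setOf_sqDist_le [Fintype ι] (p : N) (B : ℝ) :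
    {z : P.coweightLattice | sqDist P z p ≤ B}.Finite := by
  refine Set.Finite.of_injOn (f := fun z i ↦ rootVal P i z)
    (t := Set.univ.pi fun i ↦ Set.Icc ⌈P.root' i p - (1 + B)⌉ ⌊P.root' i p + (1 + B)⌋)
    (fun z hz i _ ↦ ?_) (fun z _ z' _ h ↦ rootVal_ext fun i ↦ congrFun h i)
    (Set.Finite.pi fun _ ↦ Set.finite_Icc _ _)
  have hsq : ((rootVal P i z : ℝ) - P.root' i p) ^ 2 ≤ B := by
    rw [coe_rootVal, ← map_sub]
    exact (Finset.single_le_sum (f := fun j ↦ P.root' j ((z : N) - p) ^ 2)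
      (fun j _ ↦ sq_nonneg _) (Finset.mem_univ i)).trans hz
  rw [Set.mem_Icc, Int.ceil_le, Int.le_floor]
  constructor <;> nlinarith

lemma finite_extendedAffineOrbit_inter [Fintype ι] (p p₀ : N) (B : ℝ) :
    (extendedAffineOrbit P p ∩ {y | sqDist P y p₀ ≤ B}).Finite := by
  have := finite_weylGroup (P := P)
  refine (Set.finite_iUnion fun w : P.weylGroup ↦
    (finite_setOf_sqDist_le (P := P) (p₀ - P.weylAct w p) B).image
      fun z : P.coweightLattice ↦ P.weylAct w p + (z : N)).subset ?_
  rintro _ ⟨⟨w, z, rfl⟩, hy⟩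
  refine Set.mem_iUnion.2 ⟨w, z, ?_, rfl⟩
  rwa [Set.mem_ofPred_eq, sqDist, sub_sub_eq_add_sub, add_comm (z : N)]

/-- The point of the orbit closest to `p₀`: reflecting it in a hyperplane separating it from `p₀`
would bring it closer. -/
lemma exists_mem_extendedAffineOrbit_not_separated [Finite ι] [P.IsCrystallographic] (p p₀ : N) :
    ∃ y ∈ extendedAffineOrbit P p, ∀ (i : ι) (m : ℤ),
      0 ≤ (P.root' i y - m) * (P.root' i p₀ - m) := by
  have := Fintype.ofFinite ι
  obtain ⟨y, ⟨hy, hyp⟩, hmin⟩ := Set.exists_min_image _ (sqDist P · p₀)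
    (finite_extendedAffineOrbit_inter (P := P) p p₀ (sqDist P p p₀))
    ⟨p, self_mem_extendedAffineOrbit p, le_refl (sqDist P p p₀)⟩
  refine ⟨y, hy, fun i m ↦ ?_⟩
  by_contra! hsep
  have hlt := sqDist_reflection_lt i m y p₀ hsep
  exact hlt.not_ge <| hmin _
    ⟨reflection_mem_extendedAffineOrbit hy i m, hlt.le.trans hyp⟩

end AffineWeyl

/-! ### Alcoves and their shifts -/

section Alcove

open RootPairing

variable {ι M N : Type*} [AddCommGroup M] [Module ℝ M] [AddCommGroup N] [Module ℝ N]

/-- The tuple `k` is the address of an alcove: some point `p` satisfies `kᵢ < αᵢ(p) < kᵢ + 1` for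
all roots `αᵢ`. The alcove itself is the set of these points. -/
def IsAlcove (P : RootPairing ι ℝ M N) (k : ι → ℤ) : Prop :=
  ∃ p : N, ∀ i, (k i : ℝ) < P.root' i p ∧ P.root' i p < k i + 1

/-- Translation by `ρ` maps the lattice points of the closed alcove `k`, dilated by `n`, onto those
of the open alcove, dilated by `n + h`. -/
def IsShift (P : RootPairing ι ℝ M N) (h : ℕ) (k : ι → ℤ) (ρ : P.coweightLattice) : Prop :=
  ∀ (n : ℕ) (x : P.coweightLattice),
    (∀ i, n * k i ≤ rootVal P i x ∧ rootVal P i x ≤ n * (k i + 1)) ↔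
      ∀ i, (n + h : ℕ) * k i < rootVal P i (x + ρ) ∧ rootVal P i (x + ρ) < (n + h : ℕ) * (k i + 1)

variable {P : RootPairing ι ℝ M N}

namespace IsShift

variable {h : ℕ} {k k' : ι → ℤ} {ρ ρ' : P.coweightLattice}

/-- For `n = 0`, the closed dilated alcove is the single point `0`. -/
lemma unique [P.IsRootSystem] (hρ : IsShift P h k ρ) (hρ' : IsShift P h k ρ') : ρ' = ρ := by
  have hopen := (hρ' 0 0).1 (by simp)
  have hclosed := (hρ 0 (ρ' - ρ)).2 (by simpa using hopen)
  refine rootVal_ext fun i ↦ ?_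
  have := hclosed i
  rw [map_sub] at this
  push_cast at this
  lia

lemma of_smul_add (w : P.weylGroup) (z : P.coweightLattice)
    (hk : ∀ i, k' (weylPerm w i) = k i + rootVal P (weylPerm w i) z)
    (hρ : IsShift P h k' ρ) : IsShift P h k (w⁻¹ • (ρ - h • z)) := by
  intro n x
  have key := hρ n (w • x + n • z)
  rw [(weylPerm w).surjective.forall, (weylPerm w).surjective.forall
    (p := fun i ↦ (n + h : ℕ) * k' i < rootVal P i (w • x + n • z + ρ) ∧
      rootVal P i (w • x + n • z + ρ) < (n + h : ℕ) * (k' i + 1))] at key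
  refine Iff.trans (forall_congr' fun i ↦ ?_) (key.trans (forall_congr' fun i ↦ ?_))
  · simp only [map_add, map_nsmul, rootVal_weylPerm_smul, hk, nsmul_eq_mul, mul_add]
    constructor <;> rintro ⟨h1, h2⟩ <;> constructor <;> linarith
  · simp only [map_add, map_nsmul, rootVal_weylPerm_smul, hk, nsmul_eq_mul, mul_add,
      rootVal_inv_smul, map_sub, add_mul, Nat.cast_add]
    constructor <;> rintro ⟨h1, h2⟩ <;> constructor <;> linarith

lemma eq_smul_add [P.IsRootSystem] (w : P.weylGroup) (z : P.coweightLattice)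
    (hk : ∀ i, k' (weylPerm w i) = k i + rootVal P (weylPerm w i) z)
    (hρ : IsShift P h k ρ) (hρ' : IsShift P h k' ρ') : ρ' = w • ρ + h • z := by
  rw [(hρ'.of_smul_add w z hk).unique hρ, smul_inv_smul, sub_add_cancel]

end IsShift

lemma eq_of_not_separated {v v₀ : ℝ} {a a₀ : ℤ} (hv : a < v ∧ v < a + 1)
    (hv₀ : a₀ < v₀ ∧ v₀ < a₀ + 1) (hsep : ∀ m : ℤ, 0 ≤ (v - m) * (v₀ - m)) : a = a₀ := by
  rcases lt_trichotomy a a₀ with hlt | heq | hlt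
  · have hle : (a : ℝ) + 1 ≤ a₀ := by exact_mod_cast hlt
    nlinarith [hsep a₀]
  · exact heq
  · have hle : (a₀ : ℝ) + 1 ≤ a := by exact_mod_cast hlt
    nlinarith [hsep a]

section FundamentalAlcove

variable (b : P.Base)

open Classical in
/-- The address of the fundamental alcove, on which `0 < α < 1` for all positive roots `α`. -/
def fundamentalAlcove (i : ι) : ℤ := if b.IsPos i then 0 else -1

variable {b}

lemma forall_fundamentalAlcove_iff (p : ι → ℤ → Prop)
    (hp : letI := P.indexNeg; ∀ i, p (-i) 0 ↔ p i (-1)) :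
    (∀ i, p i (fundamentalAlcove b i)) ↔ ∀ i, b.IsPos i → p i 0 := by
  let := P.indexNeg
  refine ⟨fun h i hi ↦ by simpa [fundamentalAlcove, hi] using h i, fun h i ↦ ?_⟩
  by_cases hi : b.IsPos i
  · simpa [fundamentalAlcove, hi] using h i hi
  · simpa [fundamentalAlcove, hi] using (hp i).1 (h _ ((Base.IsPos.neg_iff_not b i).2 hi))

lemma nonempty_of_isIrreducible (P : RootPairing ι ℝ M N) [P.IsRootSystem] [P.IsIrreducible] :
    Nonempty ι := by
  by_contra hne
  rw [not_nonempty_iff] at hne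
  have := IsIrreducible.nontrivial P
  have h : Submodule.span ℝ (Set.range P.root) = ⊤ := IsRootSystem.span_root_eq_top
  rw [Set.range_eq_empty, Submodule.span_empty] at h
  exact bot_ne_top h

lemma height_lt_coxeterNumber [Finite ι] (b : P.Base) (i : ι) : b.height i < b.coxeterNumber := by
  have : b.height i ≤ ⨆ i, b.height i := le_ciSup (Set.finite_range b.height).bddAbove i
  rw [Base.coxeterNumber]
  lia

variable [Finite ι] [P.IsRootSystem]

lemma coxeterNumber_pos [P.IsIrreducible] (b : P.Base) : 0 < b.coxeterNumber := by
  obtain ⟨i⟩ := nonempty_of_isIrreducible P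
  let := P.indexNeg
  have hi := height_lt_coxeterNumber b i
  have hneg := height_lt_coxeterNumber b (-i)
  rw [b.height_reflectionPerm_self] at hneg
  lia

lemma inv_coxeterNumber_smul_mem_fundamentalAlcove [P.IsIrreducible] {ρ : P.coweightLattice}
    (hρ : ∀ i, rootVal P i ρ = b.height i) (i : ι) :
    fundamentalAlcove b i < P.root' i ((b.coxeterNumber : ℝ)⁻¹ • (ρ : N)) ∧
      P.root' i ((b.coxeterNumber : ℝ)⁻¹ • (ρ : N)) < fundamentalAlcove b i + 1 := by
  revert i
  set v : N := (b.coxeterNumber : ℝ)⁻¹ • (ρ : N) with hv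
  rw [forall_fundamentalAlcove_iff (fun i (k : ℤ) ↦ k < P.root' i v ∧ P.root' i v < k + 1)]
  · intro i hi
    have hlt : (b.height i : ℝ) < b.coxeterNumber := by exact_mod_cast height_lt_coxeterNumber b i
    have hpos : (0 : ℝ) < b.coxeterNumber := by exact_mod_cast coxeterNumber_pos b
    have hheight : (0 : ℝ) < b.height i := by exact_mod_cast b.isPos_iff.1 hi
    rw [hv, map_smul, ← coe_rootVal, hρ, smul_eq_mul, inv_mul_eq_div, Int.cast_zero, zero_add,
      div_lt_one hpos]
    exact ⟨div_pos hheight hpos, hlt⟩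
  · intro i
    have hneg : P.root' (P.reflectionPerm i i) v = -P.root' i v := by simp [root']
    simp [hneg, neg_lt, and_comm]

variable [P.IsCrystallographic] [P.IsReduced] [P.IsIrreducible]

variable (b) in
lemma exists_highest_root_coxeterNumber_eq :
    ∃ θ, b.coxeterNumber = b.height θ + 1 ∧ ∀ i, RootLE b i θ := by
  have := nonempty_of_isIrreducible P
  obtain ⟨θ, hθ⟩ := exists_highest_root b
  obtain ⟨ρ, hρ⟩ := exists_rootVal_eq_height b
  have hle (i : ι) : b.height i ≤ b.height θ := by
    rw [← hρ, ← hρ]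
    refine rootVal_le_of_rootLE (fun l hl ↦ ?_) (hθ i)
    rw [hρ, Base.height_one_of_mem_support hl]
    exact zero_le_one
  refine ⟨θ, ?_, hθ⟩
  rw [Base.coxeterNumber, add_comm,
    le_antisymm (ciSup_le hle) (le_ciSup (Set.finite_range b.height).bddAbove θ)]

lemma isShift_fundamentalAlcove {h : ℕ} {ρ : P.coweightLattice} (hh : h = b.coxeterNumber)
    (hρ : ∀ i, rootVal P i ρ = b.height i) : IsShift P h (fundamentalAlcove b) ρ := by
  obtain ⟨θ, hθ, hmax⟩ := exists_highest_root_coxeterNumber_eq b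
  intro n x
  rw [forall_fundamentalAlcove_iff
      (fun i k ↦ n * k ≤ rootVal P i x ∧ rootVal P i x ≤ n * (k + 1))
      fun i ↦ by rw [rootVal_neg]; lia,
    forall_fundamentalAlcove_iff
      (fun i k ↦ (n + h : ℕ) * k < rootVal P i (x + ρ) ∧
        rootVal P i (x + ρ) < (n + h : ℕ) * (k + 1))
      fun i ↦ by rw [rootVal_neg]; lia]
  simp only [map_add, hρ, Nat.cast_add, hh, mul_zero, zero_add, mul_one]
  constructor <;> intro hx
  · intro i hi
    have := hx i hi
    have := height_lt_coxeterNumber b i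
    rw [Base.isPos_iff] at hi
    lia
  · have hsimple : ∀ l ∈ b.support, 0 ≤ rootVal P l x := by
      intro l hl
      have := (hx l (b.isPos_of_mem_support hl)).1
      rw [Base.height_one_of_mem_support hl] at this
      lia
    have hθx : rootVal P θ x ≤ n := by
      have := (hx θ (b.isPos_iff'.2 (by have := coxeterNumber_pos b; lia))).2
      lia
    exact fun i hi ↦ ⟨rootVal_nonneg_of_isPos hi hsimple,
      (rootVal_le_of_rootLE hsimple (hmax i)).trans hθx⟩

theorem exists_isShift (b : P.Base) {h : ℕ} (hh : h = b.coxeterNumber) {k : ι → ℤ}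
    (hk : IsAlcove P k) : ∃ ρ, IsShift P h k ρ := by
  obtain ⟨ρ, hρ⟩ := exists_rootVal_eq_height b
  obtain ⟨p, hp⟩ := hk
  obtain ⟨_, ⟨w, z, rfl⟩, hsep⟩ := exists_mem_extendedAffineOrbit_not_separated (P := P) p
    ((b.coxeterNumber : ℝ)⁻¹ • (ρ : N))
  refine ⟨_, (isShift_fundamentalAlcove hh hρ).of_smul_add w z fun i ↦ ?_⟩
  refine (eq_of_not_separated ?_ (inv_coxeterNumber_smul_mem_fundamentalAlcove hρ (weylPerm w i))
    (hsep (weylPerm w i))).symm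
  rw [map_add, root'_weylPerm_weylAct, ← coe_rootVal]
  push_cast
  constructor <;> linarith [hp i]

end FundamentalAlcove

end Alcove

/-! ### Residues of the roots on `Z / q Z` -/

section Residues

open RootPairing

variable {ι M N : Type*} [AddCommGroup M] [Module ℝ M] [AddCommGroup N] [Module ℝ N]

/-- The value modulo `q` of the root `i` at a point of `Z / q Z`. -/
def rootRes (P : RootPairing ι ℝ M N) (q : ℕ) (i : ι) : P.CoweightMod q →+ ZMod q :=
  QuotientAddGroup.lift (P.coweightMul q) ((Int.castAddHom (ZMod q)).comp (rootVal P i)) (by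
    rintro _ ⟨x, rfl⟩
    simp)

variable {P : RootPairing ι ℝ M N} {q : ℕ}

lemma rootRes_mk (i : ι) (x : P.coweightLattice) :
    rootRes P q i (QuotientAddGroup.mk x) = (rootVal P i x : ZMod q) := rfl

lemma rootRes_mk_eq_zero_iff {i : ι} {x : P.coweightLattice} :
    rootRes P q i (QuotientAddGroup.mk x) = 0 ↔ (q : ℤ) ∣ rootVal P i x := by
  rw [rootRes_mk, ZMod.intCast_zmod_eq_zero_iff_dvd]

lemma smul_mk (w : P.weylGroup) (x : P.coweightLattice) :
    w • (QuotientAddGroup.mk x : P.CoweightMod q) = QuotientAddGroup.mk (w • x) := rfl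

lemma rootRes_weylPerm_smul (w : P.weylGroup) (i : ι) (y : P.CoweightMod q) :
    rootRes P q (weylPerm w i) (w • y) = rootRes P q i y := by
  induction y using QuotientAddGroup.induction_on with
  | H x => rw [smul_mk, rootRes_mk, rootVal_weylPerm_smul, rootRes_mk]

lemma mem_complement_iff {y : P.CoweightMod q} :
    y ∈ P.complement q ↔ ∀ i, rootRes P q i y ≠ 0 := by
  have hroot (x : P.coweightLattice) (i : ι) : rootRes P q i (QuotientAddGroup.mk x) = 0 ↔
      ∃ k : ℤ, P.toLinearMap (P.root i) (x : N) = q * k := by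
    rw [rootRes_mk_eq_zero_iff]
    refine exists_congr fun k ↦ ?_
    rw [← Int.cast_inj (α := ℝ), coe_rootVal, Int.cast_mul, Int.cast_natCast]
  constructor
  · rintro ⟨x, rfl, hx⟩ i h
    exact hx i ((hroot x i).1 h)
  · intro h
    induction y using QuotientAddGroup.induction_on with
    | H x => exact ⟨x, rfl, fun i hi ↦ h i ((hroot x i).2 hi)⟩

lemma mk_eq_mk_iff {x x' : P.coweightLattice} :
    (QuotientAddGroup.mk x : P.CoweightMod q) = QuotientAddGroup.mk x' ↔ ∃ z, x' = x + q • z := by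
  rw [QuotientAddGroup.eq]
  refine exists_congr fun z ↦ ?_
  rw [nsmulAddMonoidHom_apply, eq_neg_add_iff_add_eq, eq_comm]

lemma exists_eq_nsmul_of_forall_dvd (hq : 0 < q) {x : P.coweightLattice}
    (h : ∀ i, (q : ℤ) ∣ rootVal P i x) : ∃ z, x = q • z := by
  have hq' : (q : ℝ) ≠ 0 := by exact_mod_cast hq.ne'
  refine ⟨⟨(q : ℝ)⁻¹ • (x : N), fun i ↦ ?_⟩, ?_⟩
  · obtain ⟨k, hk⟩ := h i
    refine ⟨k, ?_⟩
    change P.root' i _ = _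
    rw [map_smul, ← coe_rootVal, hk, smul_eq_mul, Int.cast_mul, Int.cast_natCast,
      inv_mul_cancel_left₀ hq']
  · apply Subtype.ext
    rw [AddSubgroup.coe_nsmul, ← Nat.cast_smul_eq_nsmul ℝ, smul_inv_smul₀ hq']

lemma rootRes_ext (hq : 0 < q) {y y' : P.CoweightMod q}
    (h : ∀ i, rootRes P q i y = rootRes P q i y') : y = y' := by
  induction y using QuotientAddGroup.induction_on with
  | H x =>
  induction y' using QuotientAddGroup.induction_on with
  | H x' =>
  obtain ⟨z, hz⟩ := exists_eq_nsmul_of_forall_dvd hq (x := x' - x) fun i ↦ by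
    rw [map_sub]
    exact (ZMod.intCast_eq_intCast_iff_dvd_sub _ _ _).1 (h i)
  exact mk_eq_mk_iff.2 ⟨z, by rw [← hz, add_sub_cancel]⟩

lemma finite_coweightMod [Finite ι] (hq : 0 < q) : Finite (P.CoweightMod q) := by
  have : NeZero q := ⟨hq.ne'⟩
  exact Finite.of_injective (fun y i ↦ rootRes P q i y)
    fun y y' h ↦ rootRes_ext hq fun i ↦ congrFun h i

lemma smul_eq_self_iff (hq : 0 < q) {w : P.weylGroup} {y : P.CoweightMod q} :
    w • y = y ↔ ∀ i, rootRes P q (weylPerm w i) y = rootRes P q i y := by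
  refine ⟨fun h i ↦ ?_, fun h ↦ rootRes_ext hq fun i ↦ ?_⟩
  · rw [← rootRes_weylPerm_smul w i y, h]
  · obtain ⟨i, rfl⟩ := (weylPerm w).surjective i
    rw [rootRes_weylPerm_smul, h]

end Residues

/-! ### Points of `Z / q Z` as homomorphisms on the root lattice -/

section ResidueHom

open RootPairing

variable {ι M N : Type*} [AddCommGroup M] [Module ℝ M] [AddCommGroup N] [Module ℝ N]
  {P : RootPairing ι ℝ M N} {q : ℕ}

/-- The subspace of the points of `N` fixed by `w`. -/
def fixedSpace (w : P.weylGroup) : Submodule ℝ N :=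
  LinearMap.eqLocus (P.weylAct w : N →ₗ[ℝ] N) LinearMap.id

lemma mem_fixedSpace_iff {w : P.weylGroup} {v : N} : v ∈ fixedSpace w ↔ P.weylAct w v = v :=
  Iff.rfl

section Base

variable (b : P.Base)

/-- The homomorphism from the root lattice to `ℤ/q` whose value at the root `i` is `rootRes P q i y`
(see `residueHom_rootSpanMem`). -/
def residueHom (q : ℕ) (y : P.CoweightMod q) : P.rootSpan ℤ →ₗ[ℤ] ZMod q :=
  b.toWeightBasisInt.constr ℤ fun j ↦ rootRes P q j y

lemma rootRes_eq_sum {f : ι → ℤ} {i : ι} (hf : P.root i = ∑ j ∈ b.support, f j • P.root j)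
    (y : P.CoweightMod q) : rootRes P q i y = ∑ j ∈ b.support, f j • rootRes P q j y := by
  induction y using QuotientAddGroup.induction_on with
  | H x =>
    have hval : rootVal P i x = ∑ j ∈ b.support, f j * rootVal P j x := by
      apply Int.cast_injective (α := ℝ)
      simp [coe_rootVal, root', hf]
    simp [rootRes_mk, hval]

lemma residueHom_rootSpanMem (y : P.CoweightMod q) (i : ι) :
    residueHom b q y (P.rootSpanMem ℤ i) = rootRes P q i y := by
  obtain ⟨f, -, -, hf⟩ := b.exists_root_eq_sum_int i
  rw [rootSpanMem_eq_sum b hf, rootRes_eq_sum b hf, map_sum,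
    ← Finset.sum_coe_sort b.support fun j ↦ f j • rootRes P q j y]
  exact Finset.sum_congr rfl fun j _ ↦ by rw [map_smul, residueHom, Basis.constr_basis]

lemma residueHom_bijective [P.IsRootSystem] (hq : 0 < q) :
    Function.Bijective (residueHom b q) := by
  refine ⟨fun y y' h ↦ rootRes_ext hq fun i ↦ ?_, fun φ ↦ ?_⟩
  · rw [← residueHom_rootSpanMem b, ← residueHom_rootSpanMem b, h]
  · choose c hc using fun j : b.support ↦ ZMod.intCast_surjective (φ (b.toWeightBasisInt j))
    obtain ⟨x, hx⟩ := exists_rootVal_eq b (b.toWeightBasisInt.constr ℤ c)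
    refine ⟨QuotientAddGroup.mk x, b.toWeightBasisInt.ext fun j ↦ ?_⟩
    have hj : b.toWeightBasisInt j = P.rootSpanMem ℤ j := Subtype.ext (by simp)
    rw [residueHom, Basis.constr_basis, rootRes_mk, hx, ← hj, Basis.constr_basis, hc]

end Base

/-- The relations on the root lattice satisfied by the points fixed by `w` at which the roots in
`S` vanish. -/
def relations (w : P.weylGroup) (S : Finset ι) : Submodule ℤ (P.rootSpan ℤ) :=
  Submodule.span ℤ (Set.range (fun i ↦ P.rootSpanMem ℤ (weylPerm w i) - P.rootSpanMem ℤ i) ∪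
    P.rootSpanMem ℤ '' S)

lemma forall_mem_relations_iff {A : Type*} [AddCommGroup A] (w : P.weylGroup) (S : Finset ι)
    (φ : P.rootSpan ℤ →ₗ[ℤ] A) :
    (∀ a ∈ relations w S, φ a = 0) ↔
      (∀ i, φ (P.rootSpanMem ℤ (weylPerm w i)) = φ (P.rootSpanMem ℤ i)) ∧
        ∀ i ∈ S, φ (P.rootSpanMem ℤ i) = 0 := by
  change relations w S ≤ LinearMap.ker φ ↔ _
  rw [relations, Submodule.span_le, Set.union_subset_iff, Set.range_subset_iff,
    Set.image_subset_iff]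
  refine and_congr (forall_congr' fun i ↦ ?_) Iff.rfl
  rw [SetLike.mem_coe, LinearMap.mem_ker, map_sub, sub_eq_zero]

theorem exists_isQuasiPoly_card_fixed_vanishing [P.IsRootSystem] (b : P.Base) (w : P.weylGroup)
    (S : Finset ι) : ∃ g, IsQuasiPoly g ∧
      (∀ q, g (-q) = (-1) ^ finrank ℝ
        (fixedSpace w ⊓ ⨅ i ∈ S, LinearMap.ker (P.root' i) : Submodule ℝ N) * g q) ∧
      ∀ q : ℕ, 0 < q → (Nat.card {y : P.CoweightMod q //
        w • y = y ∧ ∀ i ∈ S, rootRes P q i y = 0} : ℂ) = g q := by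
  obtain ⟨g, hg, hneg, hcard⟩ := exists_isQuasiPoly_card_annihilator b.toWeightBasisInt
    (realEquiv b) (relations w S) (fixedSpace w ⊓ ⨅ i ∈ S, LinearMap.ker (P.root' i)) fun v ↦ by
      rw [forall_mem_relations_iff, Submodule.mem_inf, mem_fixedSpace_iff, weylAct_eq_self_iff]
      simp only [realEquiv_apply, Submodule.mem_iInf, LinearMap.mem_ker]
  refine ⟨g, hg, hneg, fun q hq ↦ ?_⟩
  rw [← hcard q hq, Nat.cast_inj]
  refine Nat.card_congr ((Equiv.ofBijective _ (residueHom_bijective b hq)).subtypeEquiv fun y ↦ ?_)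
  rw [forall_mem_relations_iff, smul_eq_self_iff hq]
  simp only [Equiv.ofBijective_apply, residueHom_rootSpanMem]

end ResidueHom

/-! ### Corners of dilated alcoves -/

section Corner

open RootPairing Filter Topology

lemma card_eq_of_surjective_of_eq_iff {α β γ : Type*} {f : γ → α} {g : γ → β}
    (hf : Function.Surjective f) (hg : Function.Surjective g)
    (h : ∀ c c', f c = f c' ↔ g c = g c') : Nat.card α = Nat.card β :=
  Nat.card_congr <| (Setoid.quotientKerEquivOfSurjective f hf).symm.trans <|
    (Quotient.congrRight fun c c' ↦ h c c').trans (Setoid.quotientKerEquivOfSurjective g hg)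

lemma eq_of_mul_lt_of_lt_mul {d a k k' : ℤ} (hd : 0 < d) (hk : d * k < a ∧ a < d * (k + 1))
    (hk' : d * k' < a ∧ a < d * (k' + 1)) : k = k' := by
  have := lt_of_mul_lt_mul_left (hk.1.trans hk'.2) hd.le
  have := lt_of_mul_lt_mul_left (hk'.1.trans hk.2) hd.le
  lia

lemma eq_of_mul_le_of_le_mul {d a k k' : ℤ} (hd : 0 < d) (hk : d * k ≤ a ∧ a ≤ d * (k + 1))
    (hk' : d * k' ≤ a ∧ a ≤ d * (k' + 1)) (h : a = d * k ↔ a = d * k') : k = k' := by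
  by_cases hak : a = d * k
  · exact mul_left_cancel₀ hd.ne' (hak.symm.trans (h.1 hak))
  · have := lt_of_mul_lt_mul_left ((lt_of_le_of_ne hk.1 (Ne.symm hak)).trans_le hk'.2) hd.le
    have := lt_of_mul_lt_mul_left
      ((lt_of_le_of_ne hk'.1 (Ne.symm (mt h.2 hak))).trans_le hk.2) hd.le
    lia

lemma exists_mul_le_le_mul {d a : ℤ} (hd : 0 < d) {p : Prop} (hp : p → d ∣ a) :
    ∃ k, (d * k ≤ a ∧ a ≤ d * (k + 1)) ∧ (a = d * k ↔ p) := by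
  by_cases h : p
  · obtain ⟨k, rfl⟩ := hp h
    exact ⟨k, ⟨le_rfl, mul_le_mul_of_nonneg_left (by lia) hd.le⟩, by simpa⟩
  · have hmod := Int.emod_add_mul_ediv (a - 1) d
    have := Int.emod_nonneg (a - 1) hd.ne'
    have := Int.emod_lt_of_pos (a - 1) hd
    refine ⟨(a - 1) / d, ⟨?_, ?_⟩, iff_of_false (fun ha ↦ ?_) h⟩ <;> linarith

lemma exists_mul_lt_lt_mul {d a : ℤ} (hd : 0 < d) (ha : ¬ d ∣ a) :
    ∃ k, d * k < a ∧ a < d * (k + 1) := by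
  obtain ⟨k, ⟨hle, hle'⟩, -⟩ := exists_mul_le_le_mul hd (p := False) (a := a) False.elim
  exact ⟨k, lt_of_le_of_ne hle fun h ↦ ha ⟨k, h.symm⟩, lt_of_le_of_ne hle' fun h ↦ ha ⟨_, h⟩⟩

lemma not_dvd_of_mul_lt_of_lt_mul {d a k : ℤ} (hd : 0 < d) (hk : d * k < a ∧ a < d * (k + 1)) :
    ¬ d ∣ a := by
  rintro ⟨m, rfl⟩
  have := lt_of_mul_lt_mul_left hk.1 hd.le
  have := lt_of_mul_lt_mul_left hk.2 hd.le
  lia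

lemma eventually_lt_add_mul {a b c : ℝ} (hle : b ≤ a) (h : b = a → 0 < c) :
    ∀ᶠ t in 𝓝[>] (0 : ℝ), b < a + t * c := by
  rcases hle.lt_or_eq with hlt | rfl
  · have hcont : Continuous fun t : ℝ ↦ a + t * c := by fun_prop
    have htend : Tendsto (fun t : ℝ ↦ a + t * c) (𝓝[>] 0) (𝓝 a) := by
      simpa using (hcont.tendsto 0).mono_left nhdsWithin_le_nhds
    exact htend.eventually_const_lt hlt
  · filter_upwards [self_mem_nhdsWithin] with t ht
    exact lt_add_of_pos_right b (mul_pos ht (h rfl))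

variable {ι M N : Type*} [AddCommGroup M] [Module ℝ M] [AddCommGroup N] [Module ℝ N]

/-- A lattice point of a closed alcove dilated by `q`, together with the address and the shift of
this alcove. -/
structure Corner (P : RootPairing ι ℝ M N) (q h : ℕ) where
  /-- The lattice point. -/
  point : P.coweightLattice
  /-- The address of the alcove. -/
  address : ι → ℤ
  /-- The shift of the alcove. -/
  shift : P.coweightLattice
  isShift : IsShift P h address shift
  le_point : ∀ i, q * address i ≤ rootVal P i point ∧ rootVal P i point ≤ q * (address i + 1)

variable {P : RootPairing ι ℝ M N} {q h : ℕ}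

lemma smul_mk_eq_mk_iff {w : P.weylGroup} {x x' : P.coweightLattice} :
    w • (QuotientAddGroup.mk x : P.CoweightMod q) = QuotientAddGroup.mk x' ↔
      ∃ z, x' = w • x + q • z :=
  mk_eq_mk_iff (x := w • x)

lemma rootVal_weylPerm_smul_add_nsmul (w : P.weylGroup) (i : ι) (x z : P.coweightLattice) :
    rootVal P (weylPerm w i) (w • x + q • z) =
      rootVal P i x + q * rootVal P (weylPerm w i) z := by
  rw [map_add, rootVal_weylPerm_smul, map_nsmul, nsmul_eq_mul]

open Classical in
/-- The roots that vanish at a point of `Z / q Z`. -/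
def vanishing [Fintype ι] (y : P.CoweightMod q) : Finset ι :=
  Finset.univ.filter fun i ↦ rootRes P q i y = 0

lemma mem_vanishing_iff [Fintype ι] {y : P.CoweightMod q} {i : ι} :
    i ∈ vanishing y ↔ rootRes P q i y = 0 := by
  simp [vanishing]

lemma mem_vanishing_mk_iff [Fintype ι] {x : P.coweightLattice} {i : ι} :
    i ∈ vanishing (QuotientAddGroup.mk x : P.CoweightMod q) ↔ (q : ℤ) ∣ rootVal P i x := by
  rw [mem_vanishing_iff, rootRes_mk_eq_zero_iff]

lemma weylAct_inv_smul {n : ℕ} (hn : 0 < n) {w : P.weylGroup} {x z : P.coweightLattice}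
    (hx : x = w • x + n • z) :
    P.weylAct w ((n : ℝ)⁻¹ • (x : N)) = (n : ℝ)⁻¹ • (x : N) - (z : N) := by
  have hn' : (n : ℝ) ≠ 0 := by exact_mod_cast hn.ne'
  rw [eq_sub_iff_add_eq, map_smul, ← coe_smul_coweightLattice, ← inv_smul_smul₀ hn' (z : N),
    ← smul_add, Nat.cast_smul_eq_nsmul, ← AddSubgroup.coe_nsmul, ← AddSubgroup.coe_add, ← hx]

lemma lt_root'_inv_smul {n : ℕ} (hn : 0 < n) {x : P.coweightLattice} {k : ι → ℤ}
    (hk : ∀ i, n * k i < rootVal P i x ∧ rootVal P i x < n * (k i + 1)) (i : ι) :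
    (k i : ℝ) < P.root' i ((n : ℝ)⁻¹ • (x : N)) ∧ P.root' i ((n : ℝ)⁻¹ • (x : N)) < k i + 1 := by
  have hn' : (0 : ℝ) < n := by exact_mod_cast hn
  rw [map_smul, ← coe_rootVal, smul_eq_mul, lt_inv_mul_iff₀ hn', inv_mul_lt_iff₀ hn']
  exact_mod_cast hk i

/-- Move from `x / q` a little in the direction `u`. -/
lemma isAlcove_of_hasSigns [Fintype ι] (hq : 0 < q) {x : P.coweightLattice} {k : ι → ℤ}
    {s : Finset ι} {u : N}
    (hu : HasSigns P.root' (vanishing (QuotientAddGroup.mk x : P.CoweightMod q)) s u)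
    (hk : ∀ i, q * k i ≤ rootVal P i x ∧ rootVal P i x ≤ q * (k i + 1))
    (hs : ∀ i, rootVal P i x = q * k i ↔ i ∈ s) : IsAlcove P k := by
  have hq' : (0 : ℝ) < q := by exact_mod_cast hq
  have hroot (i : ι) : P.root' i ((q : ℝ)⁻¹ • (x : N)) = (q : ℝ)⁻¹ * rootVal P i x := by
    rw [map_smul, ← coe_rootVal, smul_eq_mul]
  have hlower (i : ι) : ∀ᶠ t in 𝓝[>] (0 : ℝ),
      (k i : ℝ) < P.root' i ((q : ℝ)⁻¹ • (x : N)) + t * P.root' i u := by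
    rw [hroot]
    refine eventually_lt_add_mul ((le_inv_mul_iff₀ hq').2 (mod_cast (hk i).1)) fun h ↦ ?_
    have hval : rootVal P i x = q * k i := mod_cast ((eq_inv_mul_iff_mul_eq₀ hq'.ne').1 h).symm
    exact (hu i (mem_vanishing_mk_iff.2 ⟨k i, hval⟩)).1 ((hs i).1 hval)
  have hupper (i : ι) : ∀ᶠ t in 𝓝[>] (0 : ℝ),
      -(k i + 1 : ℝ) < -P.root' i ((q : ℝ)⁻¹ • (x : N)) + t * -P.root' i u := by
    rw [hroot]
    refine eventually_lt_add_mul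
      (neg_le_neg ((inv_mul_le_iff₀ hq').2 (mod_cast (hk i).2))) fun h ↦ ?_
    have hval : rootVal P i x = q * (k i + 1) :=
      mod_cast ((eq_inv_mul_iff_mul_eq₀ hq'.ne').1 (neg_injective h)).symm
    refine neg_pos.2 ((hu i (mem_vanishing_mk_iff.2 ⟨_, hval⟩)).2 fun his ↦ ?_)
    have := (hs i).2 his
    lia
  obtain ⟨t, ht⟩ := ((eventually_all.2 hlower).and (eventually_all.2 hupper)).exists
  refine ⟨(q : ℝ)⁻¹ • (x : N) + t • u, fun i ↦ ?_⟩
  rw [map_add, map_smul _ t, smul_eq_mul]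
  exact ⟨ht.1 i, by linarith [ht.2 i]⟩

namespace Corner

/-- The lattice point of the open alcove dilated by `q + h` that corresponds to the corner. -/
def target (c : Corner P q h) : P.coweightLattice := c.point + c.shift

lemma lt_target (c : Corner P q h) (i : ι) :
    (q + h : ℕ) * c.address i < rootVal P i c.target ∧
      rootVal P i c.target < (q + h : ℕ) * (c.address i + 1) :=
  (c.isShift q c.point).1 c.le_point i

/-- The affine map `x ↦ w x + z` carries the alcove of `c` to that of `c'`, and its dilation by `q`
carries the point of `c` to that of `c'`. -/
def IsImage (w : P.weylGroup) (z : P.coweightLattice) (c c' : Corner P q h) : Prop :=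
  c'.point = w • c.point + q • z ∧
    ∀ i, c'.address (weylPerm w i) = c.address i + rootVal P (weylPerm w i) z

theorem isImage_iff_target [P.IsRootSystem] (hqh : 0 < q + h) {w : P.weylGroup}
    {z : P.coweightLattice} {c c' : Corner P q h} :
    IsImage w z c c' ↔ c'.target = w • c.target + (q + h) • z := by
  have hshift
      (haddress : ∀ i, c'.address (weylPerm w i) = c.address i + rootVal P (weylPerm w i) z) :
      w • c.target + (q + h) • z = w • c.point + q • z + c'.shift := by
    rw [c.isShift.eq_smul_add w z haddress c'.isShift, target, smul_add, add_nsmul]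
    abel
  refine ⟨fun ⟨hpoint, haddress⟩ ↦ by rw [hshift haddress, ← hpoint, target], fun htarget ↦ ?_⟩
  have haddress (i : ι) : c'.address (weylPerm w i) = c.address i + rootVal P (weylPerm w i) z := by
    refine eq_of_mul_lt_of_lt_mul (Int.natCast_pos.2 hqh) (c'.lt_target _) ?_
    rw [htarget, rootVal_weylPerm_smul_add_nsmul]
    constructor <;> linarith [(c.lt_target i).1, (c.lt_target i).2]
  rw [hshift haddress, target] at htarget
  exact ⟨add_right_cancel htarget, haddress⟩

lemma exists_isImage_iff_target [P.IsRootSystem] (hqh : 0 < q + h) {w : P.weylGroup}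
    {c c' : Corner P q h} : (∃ z, IsImage w z c c') ↔
      w • (QuotientAddGroup.mk c.target : P.CoweightMod (q + h)) =
        QuotientAddGroup.mk c'.target := by
  rw [smul_mk_eq_mk_iff]
  exact exists_congr fun z ↦ isImage_iff_target hqh

lemma exists_target_eq (hqh : 0 < q + h) (hshift : ∀ k, IsAlcove P k → ∃ ρ, IsShift P h k ρ)
    {x : P.coweightLattice} (hx : ∀ i, ¬ ((q + h : ℕ) : ℤ) ∣ rootVal P i x) :
    ∃ c : Corner P q h, c.target = x := by
  choose k hk using fun i ↦ exists_mul_lt_lt_mul (Int.natCast_pos.2 hqh) (hx i)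
  obtain ⟨ρ, hρ⟩ := hshift k ⟨_, lt_root'_inv_smul hqh hk⟩
  exact ⟨⟨x - ρ, k, ρ, hρ, (hρ q (x - ρ)).2 (by simpa only [sub_add_cancel])⟩,
    sub_add_cancel x ρ⟩

variable [Fintype ι]

open Classical in
/-- The roots `α` with `α(x) = q k`, where `x` is the point and `α(x) ≥ q k` on the alcove. -/
def sides (c : Corner P q h) : Finset ι :=
  Finset.univ.filter fun i ↦ rootVal P i c.point = q * c.address i

lemma mem_sides_iff {c : Corner P q h} {i : ι} :
    i ∈ c.sides ↔ rootVal P i c.point = q * c.address i := by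
  simp [sides]

theorem isImage_iff_point (hq : 0 < q) {w : P.weylGroup} {z : P.coweightLattice}
    {c c' : Corner P q h} :
    IsImage w z c c' ↔
      c'.point = w • c.point + q • z ∧ ∀ i, weylPerm w i ∈ c'.sides ↔ i ∈ c.sides := by
  refine and_congr_right fun hpoint ↦ forall_congr' fun i ↦ ?_
  have hval := rootVal_weylPerm_smul_add_nsmul (q := q) w i c.point z
  rw [← hpoint] at hval
  rw [mem_sides_iff, mem_sides_iff]
  constructor
  · intro haddress
    rw [hval, haddress, mul_add, add_left_inj]
  · intro hsides
    refine eq_of_mul_le_of_le_mul (Int.natCast_pos.2 hq) (c'.le_point _) ?_ ?_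
    · rw [hval]
      constructor <;> linarith [(c.le_point i).1, (c.le_point i).2]
    · rw [hsides, hval, mul_add, add_left_inj]

lemma exists_isImage_iff_point (hq : 0 < q) {w : P.weylGroup} {c c' : Corner P q h} :
    (∃ z, IsImage w z c c') ↔
      w • (QuotientAddGroup.mk c.point : P.CoweightMod q) = QuotientAddGroup.mk c'.point ∧
        ∀ i, weylPerm w i ∈ c'.sides ↔ i ∈ c.sides := by
  rw [smul_mk_eq_mk_iff, ← exists_and_right]
  exact exists_congr fun z ↦ isImage_iff_point hq

/-- The direction from `point / q` to the point `target / (q + h)` of the alcove. -/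
lemma hasSigns_sides (hq : 0 < q) (c : Corner P q h) :
    HasSigns P.root' (vanishing (QuotientAddGroup.mk c.point : P.CoweightMod q)) c.sides
      (((q + h : ℕ) : ℝ)⁻¹ • (c.target : N) - (q : ℝ)⁻¹ • (c.point : N)) := by
  have hq' : (0 : ℝ) < q := by exact_mod_cast hq
  have hpoint {i : ι} {m : ℤ} (hm : rootVal P i c.point = q * m) :
      P.root' i ((q : ℝ)⁻¹ • (c.point : N)) = m := by
    rw [map_smul, ← coe_rootVal, hm, smul_eq_mul, Int.cast_mul, Int.cast_natCast,
      inv_mul_cancel_left₀ hq'.ne']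
  have halcove := lt_root'_inv_smul (Nat.add_pos_left hq h) c.lt_target
  refine fun i hi ↦ ⟨fun his ↦ ?_, fun his ↦ ?_⟩
  · rw [map_sub, hpoint (mem_sides_iff.1 his), sub_pos]
    exact (halcove i).1
  · obtain ⟨m, hm⟩ := mem_vanishing_mk_iff.1 hi
    have hle := c.le_point i
    rw [mem_sides_iff] at his
    have hm' : m = c.address i + 1 := by
      rw [hm] at hle his
      have := le_of_mul_le_mul_left hle.1 (Int.natCast_pos.2 hq)
      have := le_of_mul_le_mul_left hle.2 (Int.natCast_pos.2 hq)
      have : m ≠ c.address i := fun h ↦ his (by rw [h])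
      lia
    rw [map_sub, hpoint hm, hm', Int.cast_add, Int.cast_one, sub_neg]
    exact (halcove i).2

lemma sides_mem_regions [P.IsRootSystem] (hq : 0 < q) {w : P.weylGroup} {z : P.coweightLattice}
    {c : Corner P q h} (hc : IsImage w z c c) :
    c.sides ∈ regions P.root' (fixedSpace w)
      (vanishing (QuotientAddGroup.mk c.point : P.CoweightMod q)) := by
  have hqh : 0 < q + h := Nat.add_pos_left hq h
  refine ⟨fun i hi ↦ mem_vanishing_mk_iff.2 ⟨_, mem_sides_iff.1 hi⟩, _, ?_, c.hasSigns_sides hq⟩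
  rw [SetLike.mem_coe, mem_fixedSpace_iff, map_sub, weylAct_inv_smul hq hc.1,
    weylAct_inv_smul hqh ((isImage_iff_target hqh).1 hc), sub_sub_sub_cancel_right]

lemma exists_point_sides_eq (hq : 0 < q) (hshift : ∀ k, IsAlcove P k → ∃ ρ, IsShift P h k ρ)
    {x : P.coweightLattice} {C : Set N} {s : Finset ι}
    (hs : s ∈ regions P.root' C (vanishing (QuotientAddGroup.mk x : P.CoweightMod q))) :
    ∃ c : Corner P q h, c.point = x ∧ c.sides = s := by
  obtain ⟨hsub, u, -, hu⟩ := hs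
  choose k hk hks using fun i ↦ exists_mul_le_le_mul (Int.natCast_pos.2 hq) (p := i ∈ s)
    fun hi ↦ mem_vanishing_mk_iff.1 (hsub hi)
  obtain ⟨ρ, hρ⟩ := hshift k (isAlcove_of_hasSigns hq hu hk hks)
  exact ⟨⟨x, k, ρ, hρ, hk⟩, rfl, Finset.ext fun i ↦ mem_sides_iff.trans (hks i)⟩

end Corner

lemma weylPerm_mem_iff_of_mem_regions [Fintype ι] [P.IsRootSystem] {w : P.weylGroup}
    {y : P.CoweightMod q} (hy : w • y = y) {s : Finset ι}
    (hs : s ∈ regions P.root' (fixedSpace w) (vanishing y)) (i : ι) : weylPerm w i ∈ s ↔ i ∈ s := by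
  obtain ⟨hsub, u, hu, hsigns⟩ := hs
  have hvan : weylPerm w i ∈ vanishing y ↔ i ∈ vanishing y := by
    rw [mem_vanishing_iff, mem_vanishing_iff, ← rootRes_weylPerm_smul w i y, hy]
  by_cases hi : i ∈ vanishing y
  · rw [hsigns.mem_iff hi, hsigns.mem_iff (hvan.2 hi), weylAct_eq_self_iff.1 hu i]
  · exact iff_of_false (fun h ↦ hi (hvan.1 (hsub h))) fun h ↦ hi (hsub h)

/-- The corners that are fixed by `w` up to translation. -/
def FixedCorner (q h : ℕ) (w : P.weylGroup) : Type _ :=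
  {c : Corner P q h // ∃ z, c.IsImage w z c}

namespace FixedCorner

variable [P.IsRootSystem] {w : P.weylGroup}

/-- The class modulo `q + h` of the target of a fixed corner. -/
def targetClass (hqh : 0 < q + h) (c : FixedCorner q h w) :
    {y : P.CoweightMod (q + h) // w • y = y ∧ ∀ i, rootRes P (q + h) i y ≠ 0} :=
  ⟨QuotientAddGroup.mk c.1.target, (Corner.exists_isImage_iff_target hqh).1 c.2, fun i hi ↦
    not_dvd_of_mul_lt_of_lt_mul (Int.natCast_pos.2 hqh) (c.1.lt_target i)
      (rootRes_mk_eq_zero_iff.1 hi)⟩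

lemma targetClass_eq_iff (hqh : 0 < q + h) {c c' : FixedCorner q h w} :
    targetClass hqh c = targetClass hqh c' ↔ ∃ z, c.1.IsImage 1 z c'.1 := by
  rw [Corner.exists_isImage_iff_target hqh, one_smul, Subtype.ext_iff]
  rfl

lemma targetClass_surjective (hqh : 0 < q + h)
    (hshift : ∀ k, IsAlcove P k → ∃ ρ, IsShift P h k ρ) :
    Function.Surjective (targetClass (w := w) hqh) := by
  rintro ⟨y, hy, hne⟩
  induction y using QuotientAddGroup.induction_on with
  | H x =>
    obtain ⟨c, rfl⟩ := Corner.exists_target_eq hqh hshift fun i hi ↦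
      hne i (rootRes_mk_eq_zero_iff.2 hi)
    exact ⟨⟨c, (Corner.exists_isImage_iff_target hqh).2 hy⟩, rfl⟩

variable [Fintype ι]

/-- The class modulo `q` of the point of a fixed corner, together with the region of the roots that
vanish there in which its alcove lies. -/
def region (hq : 0 < q) (c : FixedCorner q h w) :
    Σ y : {y : P.CoweightMod q // w • y = y}, regions P.root' (fixedSpace w) (vanishing y.1) :=
  ⟨⟨QuotientAddGroup.mk c.1.point, ((Corner.exists_isImage_iff_point hq).1 c.2).1⟩, c.1.sides,
    Corner.sides_mem_regions hq c.2.choose_spec⟩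

lemma region_eq_iff (hq : 0 < q) {c c' : FixedCorner q h w} :
    region hq c = region hq c' ↔ ∃ z, c.1.IsImage 1 z c'.1 := by
  rw [Corner.exists_isImage_iff_point hq, one_smul]
  constructor
  · intro hcc'
    exact ⟨congrArg (fun a ↦ a.1.1) hcc', fun i ↦
      (congrArg (fun a ↦ i ∈ a.2.1) hcc').symm.to_iff⟩
  · rintro ⟨hpoint, hsides⟩
    exact Sigma.subtype_ext (Subtype.ext hpoint) (Finset.ext fun i ↦ (hsides i).symm)

lemma region_surjective (hq : 0 < q) (hshift : ∀ k, IsAlcove P k → ∃ ρ, IsShift P h k ρ) :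
    Function.Surjective (region (h := h) (w := w) hq) := by
  rintro ⟨⟨y, hy⟩, s, hs⟩
  induction y using QuotientAddGroup.induction_on with
  | H x =>
    obtain ⟨c, rfl, rfl⟩ := Corner.exists_point_sides_eq hq hshift hs
    exact ⟨⟨c, (Corner.exists_isImage_iff_point hq).2
      ⟨hy, weylPerm_mem_iff_of_mem_regions hy hs⟩⟩, rfl⟩

end FixedCorner

theorem card_sigma_regions [Fintype ι] [P.IsRootSystem] (hq : 0 < q)
    (hshift : ∀ k, IsAlcove P k → ∃ ρ, IsShift P h k ρ) (w : P.weylGroup) :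
    Nat.card (Σ y : {y : P.CoweightMod q // w • y = y},
      regions P.root' (fixedSpace w) (vanishing y.1)) =
    Nat.card {y : P.CoweightMod (q + h) // w • y = y ∧ ∀ i, rootRes P (q + h) i y ≠ 0} :=
  have hqh : 0 < q + h := Nat.add_pos_left hq h
  card_eq_of_surjective_of_eq_iff (FixedCorner.region_surjective hq hshift)
    (FixedCorner.targetClass_surjective hqh hshift) fun _ _ ↦
    (FixedCorner.region_eq_iff hq).trans (FixedCorner.targetClass_eq_iff hqh).symm

end Corner

/-! ### The equivariant characteristic quasi-polynomial -/

section Count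

open RootPairing

variable {ι M N : Type*} [AddCommGroup M] [Module ℝ M] [AddCommGroup N] [Module ℝ N]
  {P : RootPairing ι ℝ M N} {q h : ℕ}

lemma permChar_eq_card (q : ℕ) (w : P.weylGroup) : P.permChar q w =
    Nat.card {y : P.CoweightMod q // w • y = y ∧ ∀ i, rootRes P q i y ≠ 0} := by
  rw [permChar, Nat.cast_inj]
  exact Nat.card_congr
    { toFun y := ⟨y.1.1, congrArg Subtype.val y.2, mem_complement_iff.1 y.1.2⟩
      invFun y := ⟨⟨y.1, mem_complement_iff.2 y.2.2⟩, Subtype.ext y.2.1⟩ }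

lemma neg_one_pow_finrank_mul_delta [FiniteDimensional ℝ N] (w : P.weylGroup) :
    (-1) ^ finrank ℝ N * P.delta w = (-1) ^ P.fixedDim w := by
  obtain ⟨m, hm⟩ := Nat.exists_eq_add_of_le (show P.fixedDim w ≤ finrank ℝ N from
    Submodule.finrank_le _)
  rw [delta, hm, Nat.add_sub_cancel_left, pow_add, mul_assoc, ← mul_pow]
  simp

lemma sum_mul_card_subset {Y : Type*} [Fintype ι] [Fintype Y] (v : Y → Finset ι)
    (f : Finset ι → ℤ) :
    ∑ S, f S * Nat.card {y // S ⊆ v y} = ∑ y, ∑ S ∈ (v y).powerset, f S := by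
  classical
  simp only [← Finset.filter_subset_univ, Finset.sum_filter]
  rw [Finset.sum_comm]
  refine Finset.sum_congr rfl fun S _ ↦ ?_
  rw [← Finset.sum_filter, Finset.sum_const, nsmul_eq_mul, mul_comm, Nat.card_eq_fintype_card,
    Fintype.card_subtype]

lemma sum_mul_card_fixed_vanishing [Fintype ι] (w : P.weylGroup)
    [Fintype {y : P.CoweightMod q // w • y = y}]
    (f : Finset ι → ℤ) :
    ∑ S, f S * Nat.card {y : P.CoweightMod q // w • y = y ∧ ∀ i ∈ S, rootRes P q i y = 0} =
      ∑ y : {y : P.CoweightMod q // w • y = y}, ∑ S ∈ (vanishing y.1).powerset, f S := by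
  rw [← sum_mul_card_subset]
  refine Finset.sum_congr rfl fun S _ ↦ congrArg (fun n : ℕ ↦ f S * n) ?_
  rw [← Nat.card_congr (Equiv.subtypeSubtypeEquivSubtypeInter _ _)]
  simp only [Finset.subset_iff, mem_vanishing_iff]

lemma card_complement_eq_sum [Fintype ι] (hq : 0 < q) (w : P.weylGroup) :
    (Nat.card {y : P.CoweightMod q // w • y = y ∧ ∀ i, rootRes P q i y ≠ 0} : ℤ) =
      ∑ S : Finset ι, (-1 : ℤ) ^ S.card *
        (Nat.card {y : P.CoweightMod q // w • y = y ∧ ∀ i ∈ S, rootRes P q i y = 0} : ℤ) := by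
  classical
  have := finite_coweightMod (P := P) hq
  have := Fintype.ofFinite {y : P.CoweightMod q // w • y = y}
  rw [sum_mul_card_fixed_vanishing,
    ← Nat.card_congr (Equiv.subtypeSubtypeEquivSubtypeInter (fun y ↦ w • y = y) _)]
  simp only [Finset.sum_powerset_neg_one_pow_card, Finset.sum_boole, Nat.card_eq_fintype_card,
    Fintype.card_subtype, Finset.eq_empty_iff_forall_notMem, mem_vanishing_iff, ne_eq]

variable [P.IsRootSystem]

lemma card_complement_add_eq_sum [Fintype ι] [FiniteDimensional ℝ N] (hq : 0 < q)
    (hshift : ∀ k, IsAlcove P k → ∃ ρ, IsShift P h k ρ) (w : P.weylGroup) :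
    (-1) ^ P.fixedDim w *
        (Nat.card {y : P.CoweightMod (q + h) // w • y = y ∧ ∀ i, rootRes P (q + h) i y ≠ 0} : ℤ) =
      ∑ S : Finset ι, (-1 : ℤ) ^ S.card * (-1) ^ finrank ℝ
          (fixedSpace w ⊓ ⨅ i ∈ S, LinearMap.ker (P.root' i) : Submodule ℝ N) *
        (Nat.card {y : P.CoweightMod q // w • y = y ∧ ∀ i ∈ S, rootRes P q i y = 0} : ℤ) := by
  have := finite_coweightMod (P := P) hq
  have := Fintype.ofFinite {y : P.CoweightMod q // w • y = y}
  have (y : {y : P.CoweightMod q // w • y = y}) :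
      Finite (regions P.root' (fixedSpace w) (vanishing y.1)) := finite_regions.to_subtype
  rw [sum_mul_card_fixed_vanishing, ← card_sigma_regions hq hshift, Nat.card_sigma, Nat.cast_sum,
    Finset.mul_sum]
  exact Finset.sum_congr rfl fun y _ ↦ (sum_neg_one_pow_finrank_eq_ncard_regions _ _ _).symm

theorem exists_isQuasiPoly_permChar [Finite ι] (b : P.Base)
    (hshift : ∀ k, IsAlcove P k → ∃ ρ, IsShift P h k ρ) (w : P.weylGroup) :
    ∃ g : ℤ → ℂ, IsQuasiPoly g ∧ (∀ q : ℕ, 0 < q → g q = P.permChar q w) ∧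
      ∀ q : ℕ, 0 < q → g (-q) = (-1) ^ P.fixedDim w * P.permChar (q + h) w := by
  have : FiniteDimensional ℝ N := b.toCoweightBasis.finiteDimensional_of_finite
  have := Fintype.ofFinite ι
  choose g hg hneg hcard using exists_isQuasiPoly_card_fixed_vanishing b w
  refine ⟨∑ S, fun q ↦ (((-1) ^ S.card : ℚ) : ℂ) * g S q,
    .sum _ fun S _ ↦ (hg S).const_mul _, fun q hq ↦ ?_, fun q hq ↦ ?_⟩
  · have key := congrArg (Int.cast : ℤ → ℂ) (card_complement_eq_sum hq w)
    push_cast at key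
    simpa [permChar_eq_card, hcard _ q hq] using key.symm
  · have key := congrArg (Int.cast : ℤ → ℂ) (card_complement_add_eq_sum hq hshift w)
    push_cast at key
    simpa [permChar_eq_card, hcard _ q hq, hneg, mul_assoc] using key.symm

variable {X X' : ℤ → P.weylGroup → ℂ}

lemma exists_isEquivariantCharQuasiPoly [Finite ι] (b : P.Base)
    (hshift : ∀ k, IsAlcove P k → ∃ ρ, IsShift P h k ρ) :
    ∃ X, P.IsEquivariantCharQuasiPoly X ∧
      ∀ w, ∀ q : ℕ, 0 < q → X (-q) w = (-1) ^ P.fixedDim w * P.permChar (q + h) w := by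
  have := finite_weylGroup (P := P)
  choose g hg hpos hneg using exists_isQuasiPoly_permChar b hshift
  exact ⟨fun q w ↦ g w q, ⟨isQuasiPolynomial_iff_forall.2 hg, fun q hq w ↦ hpos w q hq⟩, hneg⟩

lemma eq_of_isEquivariantCharQuasiPoly [Finite ι] (hX : P.IsEquivariantCharQuasiPoly X)
    (hX' : P.IsEquivariantCharQuasiPoly X') : X = X' := by
  have := finite_weylGroup (P := P)
  ext q w
  exact congrFun ((isQuasiPolynomial_iff_forall.1 hX.1 w).ext_of_pos
    (isQuasiPolynomial_iff_forall.1 hX'.1 w) fun n hn ↦ by rw [hX.2 n hn, hX'.2 n hn]) q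

lemma eq_neg_one_pow_fixedDim_mul [Finite ι] (hX : P.IsEquivariantCharQuasiPoly X)
    (hneg : ∀ w, ∀ q : ℕ, 0 < q → X (-q) w = (-1) ^ P.fixedDim w * P.permChar (q + h) w)
    (q : ℤ) (w : P.weylGroup) : X q w = (-1) ^ P.fixedDim w * X (h - q) w := by
  have := finite_weylGroup (P := P)
  have hXw := isQuasiPolynomial_iff_forall.1 hX.1 w
  have key := (hXw.comp_mul_add (-1) 0).ext_of_pos
    ((hXw.comp_mul_add 1 h).const_mul ((-1) ^ P.fixedDim w)) fun n hn ↦ by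
      have hval := hX.2 (n + h) (Nat.add_pos_left hn h) w
      push_cast at hval
      simp [hneg w n hn, hval]
  simpa [sub_eq_neg_add] using congrFun key (-q)

end Count

end EquivariantCharQuasiPoly

end

theorem theorem4p6 {ι M N : Type*} [Finite ι]
    [AddCommGroup M] [Module ℝ M] [AddCommGroup N] [Module ℝ N]
    (P : RootPairing ι ℝ M N) [P.IsRootSystem] [P.IsCrystallographic] [P.IsReduced]
    [P.IsIrreducible] (b : P.Base) :
    (∃! X : ℤ → P.weylGroup → ℂ, P.IsEquivariantCharQuasiPoly X) ∧
    ∀ X : ℤ → P.weylGroup → ℂ, P.IsEquivariantCharQuasiPoly X →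
      ∀ (q : ℤ) (w : P.weylGroup),
        X q w = (-1) ^ Module.finrank ℝ N * P.delta w * X (b.coxeterNumber - q) w := by
  open EquivariantCharQuasiPoly in
  have : FiniteDimensional ℝ N := b.toCoweightBasis.finiteDimensional_of_finite
  obtain ⟨h, hh⟩ := Int.eq_ofNat_of_zero_le (coxeterNumber_pos b).le
  obtain ⟨Y, hY, hneg⟩ :=
    exists_isEquivariantCharQuasiPoly b fun _ hk ↦ exists_isShift b hh.symm hk
  refine ⟨⟨Y, hY, fun X hX ↦ eq_of_isEquivariantCharQuasiPoly hX hY⟩, fun X hX q w ↦ ?_⟩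
  obtain rfl := eq_of_isEquivariantCharQuasiPoly hX hY
  rw [neg_one_pow_finrank_mul_delta, hh]
  exact eq_neg_one_pow_fixedDim_mul hX hneg q w
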